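/- Let $d \in \mathbb{N}$ and let $C^\infty_{\mathsf{per}}$ be the space of smooth $\mathbb{Z}^d$-periodic functions $\mathbb{R}^d \to \mathbb{C}$. Fix a dyadic partition of unity, that is, $\widetilde\chi, \chi \in C^\infty_c(\mathbb{R}^d;[0,1])$ with $\operatorname{supp}\widetilde\chi \subset B(0,4/3)$, $\operatorname{supp}\chi \subset B(0,8/3)\setminus B(0,3/4)$ and $\widetilde\chi(\zeta) + \sum_{k\ge 0}\chi(\zeta/2^k) = 1$ for all $\zeta$. Put $\chi_{-1} = \widetilde\chi$, $\chi_k = \chi(\cdot/2^k)$ for $k \ge 0$, and $\delta_k f = \mathcal{F}^{-1}(\chi_k \mathcal{F} f)$ for $f \in C^\infty_{\mathsf{per}}$, where $\mathcal{F} f(\zeta) = \int e^{-i x\cdot \zeta} f(x)\,dx$; that is, $\delta_k f(x) = \sum_{n \in \mathbb{Z}^d} \chi_k(2\pi n)\, c_n(f)\, e^{2\pi i n\cdot x}$ with $c_n(f) = \int_{[0,1]^d} e^{-2\pi i n \cdot x} f(x)\,dx$. For $\alpha \in \mathbb{R}$ and $p \in [1,\infty]$, let $\mathcal{B}^\alpha_{p,\infty}$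 be the completion of $C^\infty_{\mathsf{per}}$ with respect to the norm $$\|f\|_{\mathcal{B}^\alpha_{p,\infty}} = \sup_{k \ge -1} 2^{\alpha k}\, \|\delta_k f\|_{L^p([-1,1]^d)}.$$ For $f,g \in C^\infty_{\mathsf{per}}$ define the paraproduct and the resonant product by $$f \prec g = \sum_{j < k-1} \delta_j f\, \delta_k g, \qquad f \circ g = \sum_{|j-k|\le 1} \delta_j f\, \delta_k g .$$ **Proposition.** Let $\alpha < 1$, $\beta, \gamma \in \mathbb{R}$ and $p, p_1, p_2, p_3 \in [1,\infty]$ be such that $$\beta + \gamma < 0, \qquad \alpha + \beta + \gamma > 0, \qquad \frac1p = \frac1{p_1} + \frac1{p_2} + \frac1{p_3}.$$ Then the trilinear mapping $$(f,g,h) \mapsto (f \prec g) \circ h - f\,(g \circ h),$$ defined for $f,g,h \in C^\infty_{\mathsf{per}}$, extends to a continuous trilinear map from $\mathcal{B}^\alpha_{p_1,\infty} \times \mathcal{B}^\beta_{p_2,\infty} \times \mathcal{B}^\gamma_{p_3,\infty}$ to $\mathcal{B}^{\alpha+\beta+\gamma}_{p,\infty}$. -/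

import Mathlib

open MeasureTheory
open scoped ContDiff ENNReal

namespace BesovTorus

/-- The algebra `C^∞_per` of smooth `ℤ^d`-periodic complex-valued functions on `ℝ^d`. -/
def PerSmooth (d : ℕ) : Subalgebra ℂ ((Fin d → ℝ) → ℂ) where
  carrier := {f | ContDiff ℝ ∞ f ∧
    ∀ (n : Fin d → ℤ) (x : Fin d → ℝ), f (x + fun i => (n i : ℝ)) = f x}
  mul_mem' := fun hf hg => ⟨hf.1.mul hg.1, fun n x => by simp [hf.2 n x, hg.2 n x]⟩
  add_mem' := fun hf hg => ⟨hf.1.add hg.1, fun n x => by simp [hf.2 n x, hg.2 n x]⟩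
  algebraMap_mem' := fun c => ⟨contDiff_const, fun _ _ => rfl⟩

/-- The linear form `x ↦ n · x`. -/
noncomputable def phase {d : ℕ} (n : Fin d → ℤ) : (Fin d → ℝ) →L[ℝ] ℝ :=
  ∑ i, (n i : ℝ) • ContinuousLinearMap.proj i

/-- The character `x ↦ exp(2πi n · x)`. -/
noncomputable def character {d : ℕ} (n : Fin d → ℤ) (x : Fin d → ℝ) : ℂ :=
  Complex.exp (2 * Real.pi * Complex.I * ((∑ i, (n i : ℝ) * x i : ℝ) : ℂ))

/-- The Fourier coefficient `∫_{[0,1]^d} exp(-2πi n · x) f(x) dx` of a periodic function. -/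
noncomputable def fourierCoeff {d : ℕ} (f : (Fin d → ℝ) → ℂ) (n : Fin d → ℤ) : ℂ :=
  ∫ x in Set.Icc (0 : Fin d → ℝ) 1, character (-n) x * f x

theorem character_eq {d : ℕ} (n : Fin d → ℤ) :
    character n = (fun t : ℝ => Complex.exp ((2 * Real.pi * Complex.I) * t)) ∘ phase n := by
  funext x
  simp [character, phase]

theorem character_mem {d : ℕ} (n : Fin d → ℤ) : character n ∈ PerSmooth d := by
  refine ⟨?_, fun m x => ?_⟩
  · rw [character_eq]
    exact (Complex.contDiff_exp.comp (contDiff_const.mul Complex.ofRealCLM.contDiff)).comp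
      (phase n).contDiff
  · unfold character
    have : 2 * Real.pi * Complex.I * ((∑ i, (n i : ℝ) * (x + fun i => (m i : ℝ)) i : ℝ) : ℂ)
        = 2 * Real.pi * Complex.I * ((∑ i, (n i : ℝ) * x i : ℝ) : ℂ)
          + ((∑ i, n i * m i : ℤ) : ℂ) * (2 * Real.pi * Complex.I) := by
      simp only [Pi.add_apply, mul_add, Finset.sum_add_distrib]
      push_cast
      ring
    rw [this, Complex.exp_add, Complex.exp_int_mul_two_pi_mul_I, mul_one]

theorem norm_character {d : ℕ} (n : Fin d → ℤ) (x : Fin d → ℝ) : ‖character n x‖ = 1 := by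
  unfold character
  have : 2 * Real.pi * Complex.I * ((∑ i, (n i : ℝ) * x i : ℝ) : ℂ)
      = ((2 * Real.pi * ∑ i, (n i : ℝ) * x i : ℝ) : ℂ) * Complex.I := by push_cast; ring
  rw [this, Complex.norm_exp_ofReal_mul_I]

theorem norm_iteratedFDeriv_exp (k : ℕ) (t : ℝ) :
    ‖iteratedFDeriv ℝ k (fun t : ℝ => Complex.exp ((2 * Real.pi * Complex.I) * t)) t‖
      = (2 * Real.pi) ^ k := by
  rw [norm_iteratedFDeriv_eq_norm_iteratedDeriv]
  have h : iteratedDeriv k (fun t : ℝ => Complex.exp ((2 * Real.pi * Complex.I) * t))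
      = fun t : ℝ => (2 * Real.pi * Complex.I) ^ k
          * Complex.exp ((2 * Real.pi * Complex.I) * t) := by
    induction k with
    | zero => simp
    | succ k ih =>
      rw [iteratedDeriv_succ, ih]
      funext s
      have h1 : HasDerivAt (fun s : ℝ => (2 * Real.pi * Complex.I) * (s : ℂ))
          (2 * Real.pi * Complex.I) s := by
        simpa using (Complex.ofRealCLM.hasDerivAt (x := s)).const_mul (2 * Real.pi * Complex.I)
      rw [(h1.cexp.const_mul _).deriv]
      ring
  rw [h]
  have : (2 * Real.pi * Complex.I) * (t : ℂ) = ((2 * Real.pi * t : ℝ) : ℂ) * Complex.I := by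
    push_cast; ring
  rw [norm_mul, this, Complex.norm_exp_ofReal_mul_I, mul_one, norm_pow]
  simp [abs_of_pos Real.pi_pos]

theorem norm_phase_le {d : ℕ} (n : Fin d → ℤ) : ‖phase n‖ ≤ d * (1 + ‖n‖) := by
  unfold phase
  calc ‖∑ i, (n i : ℝ) • (ContinuousLinearMap.proj i : (Fin d → ℝ) →L[ℝ] ℝ)‖
      ≤ ∑ i : Fin d, (1 + ‖n‖) := by
        refine norm_sum_le_of_le _ fun i _ => ?_
        rw [norm_smul]
        have h1 : ‖(ContinuousLinearMap.proj i : (Fin d → ℝ) →L[ℝ] ℝ)‖ ≤ 1 :=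
          ContinuousLinearMap.opNorm_le_bound _ zero_le_one fun x => by
            simpa using norm_le_pi_norm x i
        have h2 : ‖(n i : ℝ)‖ ≤ ‖n‖ := by
          rw [Int.norm_cast_real]
          exact norm_le_pi_norm n i
        nlinarith [norm_nonneg (n i : ℝ), norm_nonneg n]
    _ = d * (1 + ‖n‖) := by rw [Finset.sum_const, Finset.card_univ, Fintype.card_fin, nsmul_eq_mul]

theorem norm_iteratedFDeriv_character_le {d : ℕ} (n : Fin d → ℤ) (k : ℕ) (x : Fin d → ℝ) :
    ‖iteratedFDeriv ℝ k (character n) x‖ ≤ (2 * Real.pi * d * (1 + ‖n‖)) ^ k := by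
  have hs : ContDiff ℝ ∞ (fun t : ℝ => Complex.exp ((2 * Real.pi * Complex.I) * t)) :=
    Complex.contDiff_exp.comp (contDiff_const.mul Complex.ofRealCLM.contDiff)
  rw [character_eq, ContinuousLinearMap.iteratedFDeriv_comp_right (phase n) hs x
    (i := k) (by exact_mod_cast le_top)]
  refine (ContinuousMultilinearMap.norm_compContinuousLinearMap_le _ _).trans ?_
  rw [norm_iteratedFDeriv_exp]
  simp only [Finset.prod_const, Finset.card_univ, Fintype.card_fin]
  rw [← mul_pow, mul_assoc (2 * Real.pi)]
  have := norm_phase_le n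
  gcongr

theorem summable_prod_weight (d : ℕ) :
    Summable fun n : Fin d → ℤ => ∏ i, ((1 + ‖n i‖) ^ 2)⁻¹ := by
  have h1 : Summable fun m : ℤ => ((1 + ‖m‖) ^ 2)⁻¹ := by
    have h0 : Summable fun m : ℤ => 1 / (m : ℝ) ^ 2 :=
      Real.summable_one_div_int_pow.2 one_lt_two
    refine Summable.of_norm_bounded_eventually h0 ?_
    filter_upwards [(Set.finite_singleton (0 : ℤ)).compl_mem_cofinite] with m hm
    have hm : m ≠ 0 := hm
    rw [Real.norm_of_nonneg (by positivity), one_div, Int.norm_eq_abs, ← sq_abs (m : ℝ)]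
    have : 0 < |(m : ℝ)| := by positivity
    gcongr
    linarith
  refine summable_of_sum_le (c := (∑' m : ℤ, ((1 + ‖m‖) ^ 2)⁻¹) ^ d)
    (fun n => Finset.prod_nonneg fun i _ => by positivity) fun s => ?_
  classical
  have hsub : s ⊆ Fintype.piFinset fun i => s.image fun n => n i := by
    intro n hn
    exact Fintype.mem_piFinset.2 fun i => Finset.mem_image_of_mem _ hn
  calc ∑ n ∈ s, ∏ i, ((1 + ‖n i‖) ^ 2)⁻¹
      ≤ ∑ n ∈ Fintype.piFinset fun i => s.image fun n => n i, ∏ i, ((1 + ‖n i‖) ^ 2)⁻¹ :=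
        Finset.sum_le_sum_of_subset_of_nonneg hsub fun n _ _ =>
          Finset.prod_nonneg fun i _ => by positivity
    _ = ∏ i : Fin d, ∑ m ∈ s.image fun n => n i, ((1 + ‖m‖) ^ 2)⁻¹ := by
        rw [Finset.prod_univ_sum]
    _ ≤ ∏ i : Fin d, ∑' m : ℤ, ((1 + ‖m‖) ^ 2)⁻¹ :=
        Finset.prod_le_prod (fun i _ => Finset.sum_nonneg fun m _ => by positivity)
          fun i _ => h1.sum_le_tsum _ fun m _ => by positivity
    _ = (∑' m : ℤ, ((1 + ‖m‖) ^ 2)⁻¹) ^ d := by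
        rw [Finset.prod_const, Finset.card_univ, Fintype.card_fin]

theorem summable_weight (d : ℕ) :
    Summable fun n : Fin d → ℤ => ((1 + ‖n‖) ^ (2 * d))⁻¹ := by
  refine Summable.of_nonneg_of_le (fun n => by positivity) (fun n => ?_) (summable_prod_weight d)
  rw [Finset.prod_inv_distrib]
  refine inv_anti₀ (Finset.prod_pos fun i _ => by positivity) ?_
  calc ∏ i, (1 + ‖n i‖) ^ 2 ≤ ∏ i : Fin d, (1 + ‖n‖) ^ 2 :=
        Finset.prod_le_prod (fun i _ => by positivity) fun i _ => by
          have := norm_le_pi_norm n i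
          gcongr
    _ = _ := by simp [pow_mul]

/-- The partial derivative in the `i`-th coordinate direction. -/
noncomputable def partialDeriv {d : ℕ} (i : Fin d) (f : (Fin d → ℝ) → ℂ) (x : Fin d → ℝ) : ℂ :=
  fderiv ℝ f x (Pi.single i 1)

theorem partialDeriv_mem {d : ℕ} (i : Fin d) {f : (Fin d → ℝ) → ℂ} (hf : f ∈ PerSmooth d) :
    partialDeriv i f ∈ PerSmooth d := by
  refine ⟨?_, fun n x => ?_⟩
  · exact (hf.1.fderiv_right (m := ∞) (by simp)).clm_apply contDiff_const
  · unfold partialDeriv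
    have h : (fun y => f (y + fun i => (n i : ℝ))) = f := funext fun y => hf.2 n y
    rw [← fderiv_comp_add_right, h]

theorem integral_partialDeriv {d : ℕ} (i : Fin d) {f : (Fin d → ℝ) → ℂ} (hf : f ∈ PerSmooth d) :
    ∫ x in Set.Icc (0 : Fin d → ℝ) 1, partialDeriv i f x = 0 := by
  cases d with
  | zero => exact i.elim0
  | succ d =>
    have hd := hf.1.differentiable (by simp)
    have hc : Continuous (partialDeriv i f) := (partialDeriv_mem i hf).1.continuous
    have key := integral_divergence_of_hasFDerivAt_off_countable' (0 : Fin (d + 1) → ℝ) 1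
      (fun _ => zero_le_one) (fun j => if j = i then f else 0)
      (fun j => if j = i then fderiv ℝ f else 0) ∅ Set.countable_empty
      (fun j => by
        split_ifs
        · exact hf.1.continuous.continuousOn
        · exact continuousOn_const)
      (fun x _ j => by
        split_ifs
        · exact (hd x).hasFDerivAt
        · exact hasFDerivAt_const _ _)
      (by
        refine Continuous.integrableOn_Icc ?_
        refine continuous_finsetSum _ fun j _ => ?_
        split_ifs with h
        · subst h; exact hc
        · simpa using continuous_const)
    have e1 : (fun x => ∑ j, (if j = i then fderiv ℝ f else 0) x (Pi.single j (1 : ℝ)))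
        = partialDeriv i f := by
      funext x
      rw [Finset.sum_eq_single i]
      · simp [partialDeriv]
      · intro j _ hj; simp [hj]
      · simp
    rw [e1] at key
    rw [key]
    refine Finset.sum_eq_zero fun j _ => ?_
    split_ifs with h
    · rw [sub_eq_zero]
      congr 1
      funext y
      have := hf.2 (Pi.single j 1) (j.insertNth 0 y)
      change f (j.insertNth 1 y) = f (j.insertNth 0 y)
      rw [← this]
      congr 1
      funext l
      refine Fin.succAboveCases j ?_ (fun l => ?_) l <;> simp
    · simp

theorem partialDeriv_character {d : ℕ} (i : Fin d) (n : Fin d → ℤ) (x : Fin d → ℝ) :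
    partialDeriv i (character n) x = 2 * Real.pi * Complex.I * n i * character n x := by
  have h0 : HasFDerivAt (fun x => (2 * Real.pi * Complex.I) * (phase n x : ℂ))
      ((2 * Real.pi * Complex.I) • (Complex.ofRealCLM.comp (phase n))) x :=
    ((Complex.ofRealCLM.comp (phase n)).hasFDerivAt).const_mul _
  have h := h0.cexp
  have e : character n = fun x => Complex.exp ((2 * Real.pi * Complex.I) * (phase n x : ℂ)) :=
    character_eq n
  unfold partialDeriv
  rw [e, h.fderiv]
  simp [phase, Pi.single_apply]
  ring

theorem fourierCoeff_partialDeriv {d : ℕ} (i : Fin d) {f : (Fin d → ℝ) → ℂ}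
    (hf : f ∈ PerSmooth d) (n : Fin d → ℤ) :
    fourierCoeff (partialDeriv i f) n = 2 * Real.pi * Complex.I * n i * fourierCoeff f n := by
  have hch := character_mem (-n)
  have h := integral_partialDeriv i ((PerSmooth d).mul_mem hch hf)
  have e : ∀ x, partialDeriv i (character (-n) * f) x
      = character (-n) x * partialDeriv i f x
        - 2 * Real.pi * Complex.I * n i * (character (-n) x * f x) := by
    intro x
    have h1 := partialDeriv_character i (-n) x
    have hd1 := hch.1.differentiable (by simp) x
    have hd2 := hf.1.differentiable (by simp) x
    unfold partialDeriv at h1 ⊢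
    rw [fderiv_mul hd1 hd2]
    simp [h1]
    ring
  simp only [e] at h
  have hc1 : Continuous fun x => character (-n) x * partialDeriv i f x :=
    hch.1.continuous.mul (partialDeriv_mem i hf).1.continuous
  have hc2 : Continuous fun x => 2 * Real.pi * Complex.I * n i * (character (-n) x * f x) :=
    continuous_const.mul (hch.1.continuous.mul hf.1.continuous)
  rw [integral_sub hc1.integrableOn_Icc hc2.integrableOn_Icc, integral_const_mul, sub_eq_zero] at h
  exact h

theorem exists_fourierCoeff_le {d : ℕ} {f : (Fin d → ℝ) → ℂ} (hf : f ∈ PerSmooth d) :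
    ∃ C : ℝ, ∀ n, ‖fourierCoeff f n‖ ≤ C := by
  refine ⟨∫ x in Set.Icc (0 : Fin d → ℝ) 1, ‖f x‖, fun n => ?_⟩
  refine (norm_integral_le_integral_norm _).trans_eq ?_
  simp [norm_character]

theorem exists_coord_pow_mul_le {d : ℕ} (N : ℕ) (i : Fin d) :
    ∀ f : (Fin d → ℝ) → ℂ, f ∈ PerSmooth d → ∃ C : ℝ, ∀ n : Fin d → ℤ, ‖n i‖ ^ N * ‖fourierCoeff f n‖ ≤ C := by
  induction N with
  | zero =>
    intro f hf
    simpa using exists_fourierCoeff_le hf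
  | succ N ih =>
    intro f hf
    obtain ⟨C, hC⟩ := ih _ (partialDeriv_mem i hf)
    refine ⟨C, fun n => le_trans ?_ (hC n)⟩
    rw [fourierCoeff_partialDeriv i hf, norm_mul, pow_succ]
    have h1 : ‖(2 * Real.pi * Complex.I * n i : ℂ)‖ = 2 * Real.pi * ‖n i‖ := by
      simp [abs_of_pos Real.pi_pos, Int.norm_eq_abs]
    rw [h1, mul_assoc]
    have h2 : (1 : ℝ) ≤ 2 * Real.pi := by linarith [Real.pi_gt_three]
    have h3 : 0 ≤ ‖n i‖ * ‖fourierCoeff f n‖ := by positivity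
    have h4 := mul_le_mul_of_nonneg_right h2 h3
    rw [one_mul] at h4
    have h5 : 0 ≤ ‖n i‖ ^ N := by positivity
    calc ‖n i‖ ^ N * (‖n i‖ * ‖fourierCoeff f n‖)
        ≤ ‖n i‖ ^ N * (2 * Real.pi * (‖n i‖ * ‖fourierCoeff f n‖)) :=
          mul_le_mul_of_nonneg_left h4 h5
      _ = _ := by ring

theorem exists_decay {d : ℕ} (N : ℕ) {f : (Fin d → ℝ) → ℂ} (hf : f ∈ PerSmooth d) :
    ∃ C : ℝ, ∀ n, (1 + ‖n‖) ^ N * ‖fourierCoeff f n‖ ≤ C := by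
  obtain ⟨C₀, hC₀⟩ := exists_fourierCoeff_le hf
  choose C hC using fun i => exists_coord_pow_mul_le N i f hf
  have hCi : ∀ i, 0 ≤ C i := fun i => le_trans (by positivity) (hC i 0)
  have hC₀' : 0 ≤ C₀ := le_trans (norm_nonneg _) (hC₀ 0)
  refine ⟨2 ^ N * (C₀ + ∑ i, C i), fun n => ?_⟩
  by_cases h : ‖n‖ < 1
  · have h1 : (1 + ‖n‖) ^ N ≤ 2 ^ N := by
      gcongr
      linarith
    have h2 := hC₀ n
    have h3 : 0 ≤ ∑ i, C i := Finset.sum_nonneg fun i _ => hCi i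
    gcongr
    linarith
  · push Not at h
    have hne : Nonempty (Fin d) := by
      by_contra hn
      rw [not_nonempty_iff] at hn
      have : n = 0 := Subsingleton.elim _ _
      rw [this, norm_zero] at h
      linarith
    obtain ⟨i, hi⟩ : ∃ i, ‖n‖ = ‖n i‖ := by
      obtain ⟨i, -, hi⟩ := Finset.exists_mem_eq_sup' (Finset.univ_nonempty)
        (fun i => ‖n i‖₊)
      refine ⟨i, ?_⟩
      rw [Pi.norm_def, ← Finset.sup'_eq_sup Finset.univ_nonempty, hi]
      simp
    calc (1 + ‖n‖) ^ N * ‖fourierCoeff f n‖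
        ≤ (2 * ‖n i‖) ^ N * ‖fourierCoeff f n‖ := by
          gcongr
          linarith
      _ = 2 ^ N * (‖n i‖ ^ N * ‖fourierCoeff f n‖) := by rw [mul_pow]; ring
      _ ≤ 2 ^ N * (C₀ + ∑ i, C i) := by
          have := Finset.single_le_sum (fun i _ => hCi i) (Finset.mem_univ i)
          have := hC i n
          gcongr
          linarith

theorem summable_pow_mul_fourierCoeff {d : ℕ} (N : ℕ) {f : (Fin d → ℝ) → ℂ}
    (hf : f ∈ PerSmooth d) : Summable fun n => (1 + ‖n‖) ^ N * ‖fourierCoeff f n‖ := by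
  obtain ⟨C, hC⟩ := exists_decay (N + 2 * d) hf
  refine Summable.of_nonneg_of_le (fun n => by positivity) (fun n => ?_)
    ((summable_weight d).mul_left C)
  rw [← div_eq_mul_inv, le_div_iff₀ (by positivity)]
  refine le_trans (le_of_eq ?_) (hC n)
  rw [pow_add]
  ring

/-- A dyadic partition of unity `(χ̃, χ) = (low, ann)` on frequency space: smooth functions with
values in `[0, 1]`, supported in the ball `B(0, 4/3)` and in the annulus `B(0, 8/3) \ B(0, 3/4)`
respectively, such that `χ̃(ζ) + ∑_{k ≥ 0} χ(ζ / 2^k) = 1` for all `ζ`. -/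
structure LittlewoodPaley (d : ℕ) where
  low : EuclideanSpace ℝ (Fin d) → ℝ
  ann : EuclideanSpace ℝ (Fin d) → ℝ
  contDiff_low : ContDiff ℝ ∞ low
  contDiff_ann : ContDiff ℝ ∞ ann
  low_mem : ∀ ζ, low ζ ∈ Set.Icc (0 : ℝ) 1
  ann_mem : ∀ ζ, ann ζ ∈ Set.Icc (0 : ℝ) 1
  tsupport_low : tsupport low ⊆ Metric.ball 0 (4 / 3)
  tsupport_ann : tsupport ann ⊆ Metric.ball 0 (8 / 3) \ Metric.ball 0 (3 / 4)
  sum_eq_one : ∀ ζ, low ζ + ∑' k : ℕ, ann ((2 ^ k : ℝ)⁻¹ • ζ) = 1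

/-- Dyadic partitions of unity exist. -/
theorem nonempty_littlewoodPaley (d : ℕ) : Nonempty (LittlewoodPaley d) := by
  let b : ContDiffBump (0 : EuclideanSpace ℝ (Fin d)) := ⟨1, 5 / 4, one_pos, by norm_num⟩
  have hb1 : ∀ x : EuclideanSpace ℝ (Fin d), ‖x‖ ≤ 1 → b x = 1 := fun x hx =>
    b.one_of_mem_closedBall (by simpa using hx)
  have hb0 : ∀ x : EuclideanSpace ℝ (Fin d), 5 / 4 ≤ ‖x‖ → b x = 0 := fun x hx =>
    b.zero_of_le_dist (by simpa using hx)
  have hhalf : ∀ x : EuclideanSpace ℝ (Fin d), ‖(2 : ℝ)⁻¹ • x‖ = ‖x‖ / 2 := fun x => by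
    rw [norm_smul, Real.norm_of_nonneg (by norm_num)]; ring
  refine ⟨⟨b, fun ζ => b ((2 : ℝ)⁻¹ • ζ) - b ζ, b.contDiff, ?_, fun ζ => ⟨b.nonneg, b.le_one⟩,
    fun ζ => ?_, ?_, ?_, fun ζ => ?_⟩⟩
  · exact (b.contDiff.comp (contDiff_const_smul _)).sub b.contDiff
  · have h1 := b.nonneg' ζ
    have h2 := b.le_one (x := (2 : ℝ)⁻¹ • ζ)
    refine ⟨?_, by linarith⟩
    rcases le_total ‖ζ‖ (5 / 4) with h | h
    · rw [hb1 _ (by rw [hhalf]; linarith)]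
      linarith [b.le_one (x := ζ)]
    · rw [hb0 _ h, sub_zero]
      exact b.nonneg
  · rw [b.tsupport_eq]
    exact Metric.closedBall_subset_ball (by norm_num)
  · have hcl : IsClosed {x : EuclideanSpace ℝ (Fin d) | 1 ≤ ‖x‖ ∧ ‖x‖ ≤ 5 / 2} :=
      (isClosed_le continuous_const continuous_norm).inter
        (isClosed_le continuous_norm continuous_const)
    refine (closure_minimal (fun x hx => ?_) hcl).trans fun x hx => ?_
    · by_contra hn
      refine hx ?_
      simp only [Set.mem_ofPred_eq, not_and_or, not_le] at hn
      rcases hn with h | h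
      · change b _ - b _ = 0
        rw [hb1 x h.le, hb1 _ (by rw [hhalf]; linarith), sub_self]
      · change b _ - b _ = 0
        rw [hb0 x (by linarith), hb0 _ (by rw [hhalf]; linarith), sub_self]
    · simp only [Set.mem_sdiff, mem_ball_zero_iff, not_lt]
      exact ⟨by linarith [hx.2], by linarith [hx.1]⟩
  · have hlim : Filter.Tendsto (fun k : ℕ => b ((2 ^ k : ℝ)⁻¹ • ζ)) Filter.atTop (nhds 1) := by
      have h0 : Filter.Tendsto (fun k : ℕ => (2 ^ k : ℝ)⁻¹ • ζ) Filter.atTop (nhds 0) := by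
        have : Filter.Tendsto (fun k : ℕ => (2 ^ k : ℝ)⁻¹) Filter.atTop (nhds 0) :=
          tendsto_inv_atTop_zero.comp (tendsto_pow_atTop_atTop_of_one_lt one_lt_two)
        simpa using this.smul_const ζ
      have h1 := (b.continuous.tendsto 0).comp h0
      rwa [hb1 0 (by simp)] at h1
    have hnn : ∀ k : ℕ, 0 ≤ b ((2 : ℝ)⁻¹ • (2 ^ k : ℝ)⁻¹ • ζ) - b ((2 ^ k : ℝ)⁻¹ • ζ) := by
      intro k
      generalize (2 ^ k : ℝ)⁻¹ • ζ = ζ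
      rcases le_total ‖ζ‖ (5 / 4) with h | h
      · rw [hb1 ((2 : ℝ)⁻¹ • ζ) (by rw [hhalf]; linarith)]
        linarith [b.le_one (x := ζ)]
      · rw [hb0 ζ h, sub_zero]
        exact b.nonneg
    have hs : HasSum (fun k : ℕ => b ((2 : ℝ)⁻¹ • (2 ^ k : ℝ)⁻¹ • ζ) - b ((2 ^ k : ℝ)⁻¹ • ζ))
        (1 - b ζ) := by
      rw [hasSum_iff_tendsto_nat_of_nonneg hnn]
      have e : ∀ n : ℕ, ∑ k ∈ Finset.range n,
          (b ((2 : ℝ)⁻¹ • (2 ^ k : ℝ)⁻¹ • ζ) - b ((2 ^ k : ℝ)⁻¹ • ζ))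
            = b ((2 ^ n : ℝ)⁻¹ • ζ) - b ζ := by
        intro n
        have := Finset.sum_range_sub (fun k : ℕ => b ((2 ^ k : ℝ)⁻¹ • ζ)) n
        simp only [pow_zero, inv_one, one_smul] at this
        rw [← this]
        refine Finset.sum_congr rfl fun k _ => ?_
        rw [smul_smul, pow_succ, mul_inv, mul_comm]
      simp only [e]
      exact hlim.sub_const _
    rw [hs.tsum_eq]
    ring

/-- The cutoffs `χ_{-1} = χ̃` and `χ_k = χ(· / 2^k)`, `k ≥ 0`. The index is shifted by one:
`P.cutoff m` is `χ_{m-1}`. -/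
noncomputable def LittlewoodPaley.cutoff {d : ℕ} (P : LittlewoodPaley d) :
    ℕ → EuclideanSpace ℝ (Fin d) → ℝ
  | 0 => P.low
  | k + 1 => fun ζ => P.ann ((2 ^ k : ℝ)⁻¹ • ζ)

/-- The frequency `2πn` of the character `x ↦ exp(2πi n · x)`, for the Fourier transform normalised
as `f̂(ζ) = ∫ exp(-i x · ζ) f(x) dx`. -/
noncomputable def frequency {d : ℕ} (n : Fin d → ℤ) : EuclideanSpace ℝ (Fin d) :=
  WithLp.toLp 2 fun i => 2 * Real.pi * n i

/-- The Littlewood-Paley block `δ_k f = ℱ⁻¹(χ_k ℱ f)`, `k = m - 1`. For a smooth periodic `f`, the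
Fourier transform is `(2π)^d ∑_n c_n(f) Dirac(2πn)`, with `c_n(f)` the Fourier coefficients, hence
`δ_k f (x) = ∑_n χ_k(2πn) c_n(f) exp(2πi n · x)`. -/
noncomputable def blockFun {d : ℕ} (P : LittlewoodPaley d) (m : ℕ) (f : (Fin d → ℝ) → ℂ)
    (x : Fin d → ℝ) : ℂ :=
  ∑' n : Fin d → ℤ, ((P.cutoff m (frequency n) : ℂ) * fourierCoeff f n) • character n x

theorem norm_frequency_le {d : ℕ} (n : Fin d → ℤ) :
    ‖frequency n‖ ≤ 2 * Real.pi * d * (1 + ‖n‖) := by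
  refine abs_le_of_sq_le_sq' ?_ (by positivity) |>.2
  rw [EuclideanSpace.norm_sq_eq]
  have h : ∀ i, ‖frequency n i‖ ≤ 2 * Real.pi * (1 + ‖n‖) := fun i => by
    have h1 : ‖(n i : ℝ)‖ ≤ ‖n‖ := by
      rw [Int.norm_cast_real]
      exact norm_le_pi_norm n i
    simp only [frequency, norm_mul, Real.norm_ofNat, Real.norm_of_nonneg Real.pi_pos.le]
    have := Real.pi_pos
    gcongr
    linarith
  calc ∑ i, ‖frequency n i‖ ^ 2 ≤ ∑ i : Fin d, (2 * Real.pi * (1 + ‖n‖)) ^ 2 :=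
        Finset.sum_le_sum fun i _ => pow_le_pow_left₀ (norm_nonneg _) (h i) 2
    _ = d * (2 * Real.pi * (1 + ‖n‖)) ^ 2 := by
        rw [Finset.sum_const, Finset.card_univ, Fintype.card_fin, nsmul_eq_mul]
    _ ≤ (d : ℝ) ^ 2 * (2 * Real.pi * (1 + ‖n‖)) ^ 2 := by
        have : (d : ℝ) ≤ (d : ℝ) ^ 2 := by exact_mod_cast Nat.le_self_pow two_ne_zero d
        gcongr
    _ = _ := by ring

theorem LittlewoodPaley.cutoff_mem {d : ℕ} (P : LittlewoodPaley d) (m : ℕ)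
    (ζ : EuclideanSpace ℝ (Fin d)) : P.cutoff m ζ ∈ Set.Icc (0 : ℝ) 1 := by
  cases m with
  | zero => exact P.low_mem ζ
  | succ k => exact P.ann_mem _

theorem LittlewoodPaley.two_pow_le {d : ℕ} (P : LittlewoodPaley d) (m : ℕ) (n : Fin d → ℤ)
    (h : P.cutoff m (frequency n) ≠ 0) : (2 : ℝ) ^ m ≤ (6 * Real.pi * d + 1) * (1 + ‖n‖) := by
  have hpos : 0 ≤ Real.pi * d * (1 + ‖n‖) := by positivity
  cases m with
  | zero => nlinarith [norm_nonneg n]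
  | succ k =>
    have h1 := (P.tsupport_ann (subset_tsupport _ h)).2
    rw [mem_ball_zero_iff, not_lt, norm_smul, norm_inv, Real.norm_of_nonneg (by positivity),
      ← div_eq_inv_mul, le_div_iff₀ (by positivity)] at h1
    have h2 := norm_frequency_le n
    rw [pow_succ]
    nlinarith [norm_nonneg n]

theorem LittlewoodPaley.cutoff_mul_le {d : ℕ} (P : LittlewoodPaley d) (m N : ℕ)
    (n : Fin d → ℤ) : P.cutoff m (frequency n)
      ≤ ((2 ^ m) ^ N)⁻¹ * ((6 * Real.pi * d + 1) * (1 + ‖n‖)) ^ N := by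
  by_cases h : P.cutoff m (frequency n) = 0
  · rw [h]; positivity
  · refine (P.cutoff_mem m _).2.trans ?_
    rw [← div_eq_inv_mul, one_le_div (by positivity)]
    exact pow_le_pow_left₀ (by positivity) (P.two_pow_le m n h) N

theorem norm_block_term_le {d : ℕ} (P : LittlewoodPaley d) (f : (Fin d → ℝ) → ℂ) (m N k : ℕ)
    (n : Fin d → ℤ) (x : Fin d → ℝ) :
    ‖iteratedFDeriv ℝ k (fun x => ((P.cutoff m (frequency n) : ℂ) * fourierCoeff f n) •
        character n x) x‖
      ≤ ((2 ^ m) ^ N)⁻¹ * ((6 * Real.pi * d + 1) ^ N * (2 * Real.pi * d) ^ k *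
        ((1 + ‖n‖) ^ (N + k) * ‖fourierCoeff f n‖)) := by
  have hc : ContDiffAt ℝ k (character n) x :=
    ((character_mem n).1.of_le (by exact_mod_cast le_top)).contDiffAt
  rw [iteratedFDeriv_const_smul_apply' hc, norm_smul, norm_mul, Complex.norm_real,
    Real.norm_of_nonneg (P.cutoff_mem m _).1]
  calc P.cutoff m (frequency n) * ‖fourierCoeff f n‖ * ‖iteratedFDeriv ℝ k (character n) x‖
      ≤ (((2 ^ m) ^ N)⁻¹ * ((6 * Real.pi * d + 1) * (1 + ‖n‖)) ^ N) * ‖fourierCoeff f n‖ *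
          (2 * Real.pi * d * (1 + ‖n‖)) ^ k := by
        have h1 := P.cutoff_mul_le m N n
        have h2 := norm_iteratedFDeriv_character_le n k x
        gcongr
    _ = _ := by rw [mul_pow, mul_pow (2 * Real.pi * d), pow_add]; ring

theorem contDiff_block_term {d : ℕ} (P : LittlewoodPaley d) (f : (Fin d → ℝ) → ℂ) (m : ℕ)
    (n : Fin d → ℤ) : ContDiff ℝ ∞ (fun x => ((P.cutoff m (frequency n) : ℂ) *
      fourierCoeff f n) • character n x) :=
  (contDiff_const (c := (P.cutoff m (frequency n) : ℂ) * fourierCoeff f n)).smul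
    (character_mem n).1

theorem blockFun_mem {d : ℕ} (P : LittlewoodPaley d) (m : ℕ) {f : (Fin d → ℝ) → ℂ}
    (hf : f ∈ PerSmooth d) : blockFun P m f ∈ PerSmooth d := by
  refine ⟨?_, fun l x => ?_⟩
  · refine contDiff_tsum (N := ⊤) (contDiff_block_term P f m) (fun k _ => ?_)
      (fun k n x _ => norm_block_term_le P f m 0 k n x)
    exact ((summable_pow_mul_fourierCoeff (0 + k) hf).mul_left _).mul_left _
  · unfold blockFun
    simp only [(character_mem _).2 l x]

theorem exists_block_le {d : ℕ} (P : LittlewoodPaley d) {f : (Fin d → ℝ) → ℂ}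
    (hf : f ∈ PerSmooth d) (N k : ℕ) : ∃ C : ℝ, 0 ≤ C ∧ ∀ m x,
      ‖iteratedFDeriv ℝ k (blockFun P m f) x‖ ≤ ((2 ^ m) ^ N)⁻¹ * C := by
  have hs := fun N k : ℕ => (summable_pow_mul_fourierCoeff (N + k) hf).mul_left
    ((6 * Real.pi * d + 1) ^ N * (2 * Real.pi * d) ^ k)
  refine ⟨∑' n, (6 * Real.pi * d + 1) ^ N * (2 * Real.pi * d) ^ k *
    ((1 + ‖n‖) ^ (N + k) * ‖fourierCoeff f n‖), tsum_nonneg fun n => by positivity,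
    fun m x => ?_⟩
  · unfold blockFun
    rw [iteratedFDeriv_tsum_apply (N := ⊤) (contDiff_block_term P f m)
      (fun k _ => (hs 0 k).mul_left _) (fun k n x _ => norm_block_term_le P f m 0 k n x) le_top]
    exact tsum_of_norm_bounded ((hs N k).hasSum.mul_left _)
      fun n => norm_block_term_le P f m N k n x

theorem summable_block_term {d : ℕ} (P : LittlewoodPaley d) (m : ℕ) {f : (Fin d → ℝ) → ℂ}
    (hf : f ∈ PerSmooth d) (x : Fin d → ℝ) : Summable fun n : Fin d → ℤ =>
      ((P.cutoff m (frequency n) : ℂ) * fourierCoeff f n) • character n x := by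
  refine Summable.of_norm_bounded (((summable_pow_mul_fourierCoeff (0 + 0) hf).mul_left
    ((6 * Real.pi * d + 1) ^ 0 * (2 * Real.pi * d) ^ 0)).mul_left (((2 ^ m) ^ 0)⁻¹)) fun n => ?_
  have h := norm_block_term_le P f m 0 0 n x
  rwa [norm_iteratedFDeriv_zero] at h

/-- The block `f ↦ δ_{m-1} f` as a linear map on smooth periodic functions. -/
noncomputable def block {d : ℕ} (P : LittlewoodPaley d) (m : ℕ) :
    PerSmooth d →ₗ[ℂ] PerSmooth d where
  toFun f := ⟨blockFun P m f, blockFun_mem P m f.2⟩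
  map_add' f g := by
    have e : ∀ n, fourierCoeff (f + g : (Fin d → ℝ) → ℂ) n
        = fourierCoeff (f : (Fin d → ℝ) → ℂ) n + fourierCoeff (g : (Fin d → ℝ) → ℂ) n := by
      intro n
      unfold fourierCoeff
      rw [← integral_add]
      · simp only [Pi.add_apply, mul_add]
      · exact ((character_mem (-n)).1.continuous.mul f.2.1.continuous).integrableOn_Icc
      · exact ((character_mem (-n)).1.continuous.mul g.2.1.continuous).integrableOn_Icc
    ext x
    change blockFun P m (f + g : (Fin d → ℝ) → ℂ) x = blockFun P m f x + blockFun P m g x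
    unfold blockFun
    rw [← (summable_block_term P m f.2 x).tsum_add (summable_block_term P m g.2 x)]
    simp only [e, mul_add, add_smul]
  map_smul' c f := by
    have e : ∀ n, fourierCoeff (c • (f : (Fin d → ℝ) → ℂ)) n
        = c * fourierCoeff (f : (Fin d → ℝ) → ℂ) n := by
      intro n
      unfold fourierCoeff
      rw [← integral_const_mul]
      simp only [Pi.smul_apply, smul_eq_mul, mul_left_comm]
    ext x
    change blockFun P m (c • (f : (Fin d → ℝ) → ℂ)) x = c * blockFun P m f x
    unfold blockFun
    rw [← tsum_mul_left]
    simp only [e, smul_eq_mul, mul_assoc, mul_left_comm c]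

theorem exists_block_mul_block_le {d : ℕ} (P : LittlewoodPaley d) (f g : PerSmooth d) (k : ℕ) :
    ∃ C : ℝ, ∀ (q : ℕ × ℕ) x,
      ‖iteratedFDeriv ℝ k (fun x => (block P q.1 f : (Fin d → ℝ) → ℂ) x *
        (block P q.2 g : (Fin d → ℝ) → ℂ) x) x‖ ≤ (2 ^ q.1)⁻¹ * (2 ^ q.2)⁻¹ * C := by
  choose A hA hA' using fun k => exists_block_le P f.2 1 k
  choose B hB hB' using fun k => exists_block_le P g.2 1 k
  simp only [pow_one] at hA' hB'
  refine ⟨∑ i ∈ Finset.range (k + 1), (k.choose i : ℝ) * A i * B (k - i), fun q x => ?_⟩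
  refine (norm_iteratedFDeriv_mul_le (N := ∞) (block P q.1 f).2.1 (block P q.2 g).2.1 x
    (by exact_mod_cast le_top)).trans ?_
  rw [Finset.mul_sum]
  refine Finset.sum_le_sum fun i _ => ?_
  have h1 := hA' i q.1 x
  have h2 := hB' (k - i) q.2 x
  calc (k.choose i : ℝ) * ‖iteratedFDeriv ℝ i (blockFun P q.1 f) x‖ *
        ‖iteratedFDeriv ℝ (k - i) (blockFun P q.2 g) x‖
      ≤ (k.choose i : ℝ) * ((2 ^ q.1)⁻¹ * A i) * ((2 ^ q.2)⁻¹ * B (k - i)) := by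
        have := hA i
        gcongr
    _ = _ := by ring

theorem summable_two_pow_inv : Summable fun q : ℕ × ℕ => ((2 : ℝ) ^ q.1)⁻¹ * (2 ^ q.2)⁻¹ := by
  have h : Summable fun n : ℕ => ((2 : ℝ) ^ n)⁻¹ := by
    simpa [inv_pow] using summable_geometric_of_lt_one (r := (2 : ℝ)⁻¹) (by norm_num) (by norm_num)
  exact h.mul_of_nonneg h (fun n => by positivity) fun n => by positivity

theorem blockSum_mem {d : ℕ} (P : LittlewoodPaley d) (A : Set (ℕ × ℕ)) (f g : PerSmooth d) :
    (fun x => ∑' q : A, (block P q.1.1 f : (Fin d → ℝ) → ℂ) x *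
      (block P q.1.2 g : (Fin d → ℝ) → ℂ) x) ∈ PerSmooth d := by
  refine ⟨?_, fun n x => ?_⟩
  · choose C hC using exists_block_mul_block_le P f g
    exact contDiff_tsum (N := ⊤)
      (fun q : A => (block P q.1.1 f).2.1.mul (block P q.1.2 g).2.1)
      (fun k _ => (summable_two_pow_inv.mul_right (C k)).subtype A)
      fun k q x _ => hC k q x
  · simp only [(block P _ f).2.2 n x, (block P _ g).2.2 n x]

/-- The function `∑_{(j,k) ∈ A} δ_{j-1} f δ_{k-1} g` (an absolutely convergent series). -/
noncomputable def blockSum {d : ℕ} (P : LittlewoodPaley d) (A : Set (ℕ × ℕ))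
    (f g : PerSmooth d) : PerSmooth d :=
  ⟨fun x => ∑' q : A, (block P q.1.1 f : (Fin d → ℝ) → ℂ) x *
    (block P q.1.2 g : (Fin d → ℝ) → ℂ) x, blockSum_mem P A f g⟩

theorem hasSum_blockSum {d : ℕ} (P : LittlewoodPaley d) (A : Set (ℕ × ℕ)) (f g : PerSmooth d)
    (x : Fin d → ℝ) : HasSum (fun q : A => (block P q.1.1 f : (Fin d → ℝ) → ℂ) x *
      (block P q.1.2 g : (Fin d → ℝ) → ℂ) x) ((blockSum P A f g : (Fin d → ℝ) → ℂ) x) := by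
  obtain ⟨C, hC⟩ := exists_block_mul_block_le P f g 0
  refine Summable.hasSum (Summable.of_norm_bounded
    ((summable_two_pow_inv.mul_right C).subtype A) fun q => ?_)
  simpa using hC q x

/-- The paraproduct `f ≺ g = ∑_{j < k-1} δ_j f δ_k g`. -/
noncomputable def paraproduct {d : ℕ} (P : LittlewoodPaley d) (f g : PerSmooth d) : PerSmooth d :=
  blockSum P {q | q.1 + 1 < q.2} f g

/-- The resonant term `f ∘ g = ∑_{|j-k| ≤ 1} δ_j f δ_k g`. -/
noncomputable def resonant {d : ℕ} (P : LittlewoodPaley d) (f g : PerSmooth d) : PerSmooth d :=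
  blockSum P {q | q.1 ≤ q.2 + 1 ∧ q.2 ≤ q.1 + 1} f g

/-- The commutator `[≺,∘](f, g, h) = (f ≺ g) ∘ h - f (g ∘ h)`. -/
noncomputable def bonyCommutator {d : ℕ} (P : LittlewoodPaley d) (f g h : PerSmooth d) :
    PerSmooth d :=
  resonant P (paraproduct P f g) h - f * resonant P g h

/-- The norm of `L^p([-1,1]^d, dx)` (finite on smooth functions). -/
noncomputable def lpNorm {d : ℕ} (p : ℝ≥0∞) (f : PerSmooth d) : ℝ :=
  (eLpNorm (f : (Fin d → ℝ) → ℂ) p (volume.restrict (Set.Icc (-1 : Fin d → ℝ) 1))).toReal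

/-- The norm `sup_{k ≥ -1} 2^{αk} ‖δ_k f‖_{L^p}` of `B^α_{p,∞}`, with `k = m - 1`. The supremum is
finite for smooth periodic `f`, see `bddAbove_besovNorm`. -/
noncomputable def besovNorm {d : ℕ} (P : LittlewoodPaley d) (α : ℝ) (p : ℝ≥0∞)
    (f : PerSmooth d) : ℝ :=
  ⨆ m : ℕ, (2 : ℝ) ^ (α * ((m : ℝ) - 1)) * lpNorm p (block P m f)

theorem memLp_perSmooth {d : ℕ} (p : ℝ≥0∞) (f : PerSmooth d) :
    MemLp (f : (Fin d → ℝ) → ℂ) p (volume.restrict (Set.Icc (-1 : Fin d → ℝ) 1)) := by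
  have : IsFiniteMeasure (volume.restrict (Set.Icc (-1 : Fin d → ℝ) 1)) :=
    isFiniteMeasure_restrict.2 isCompact_Icc.measure_lt_top.ne
  obtain ⟨C, hC⟩ := isCompact_Icc.exists_bound_of_continuousOn
    (f.2.1.continuous.continuousOn (s := Set.Icc (-1 : Fin d → ℝ) 1))
  exact MemLp.of_bound f.2.1.continuous.aestronglyMeasurable C
    (ae_restrict_of_forall_mem measurableSet_Icc hC)

theorem lpNorm_add_le {d : ℕ} (p : ℝ≥0∞) [hp : Fact (1 ≤ p)] (f g : PerSmooth d) :
    lpNorm p (f + g) ≤ lpNorm p f + lpNorm p g := by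
  have hf := memLp_perSmooth p f
  have hg := memLp_perSmooth p g
  unfold lpNorm
  rw [← ENNReal.toReal_add hf.2.ne hg.2.ne]
  exact ENNReal.toReal_mono (ENNReal.add_ne_top.2 ⟨hf.2.ne, hg.2.ne⟩)
    (eLpNorm_add_le hf.1 hg.1 hp.out)

theorem lpNorm_smul {d : ℕ} (p : ℝ≥0∞) (c : ℂ) (f : PerSmooth d) :
    lpNorm p (c • f) = ‖c‖ * lpNorm p f := by
  have h := eLpNorm_const_smul c (f : (Fin d → ℝ) → ℂ) p
    (volume.restrict (Set.Icc (-1 : Fin d → ℝ) 1))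
  unfold lpNorm
  rw [← toReal_enorm, ← ENNReal.toReal_mul, ← h]
  rfl

theorem bddAbove_besovNorm {d : ℕ} (P : LittlewoodPaley d) (α : ℝ) (p : ℝ≥0∞)
    (f : PerSmooth d) : BddAbove (Set.range fun m : ℕ =>
      (2 : ℝ) ^ (α * ((m : ℝ) - 1)) * lpNorm p (block P m f)) := by
  obtain ⟨C, hC0, hC⟩ := exists_block_le P f.2 ⌈|α|⌉₊ 0
  set μ : Measure (Fin d → ℝ) := volume.restrict (Set.Icc (-1 : Fin d → ℝ) 1)
  have hμ : IsFiniteMeasure μ := isFiniteMeasure_restrict.2 isCompact_Icc.measure_lt_top.ne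
  set V : ℝ := (μ Set.univ ^ p.toReal⁻¹).toReal
  refine ⟨2 ^ (-α) * (V * C), ?_⟩
  rintro _ ⟨m, rfl⟩
  have h1 : lpNorm p (block P m f) ≤ V * (((2 ^ m) ^ ⌈|α|⌉₊)⁻¹ * C) := by
    have hb : eLpNorm (block P m f : (Fin d → ℝ) → ℂ) p μ
        ≤ μ Set.univ ^ p.toReal⁻¹ * ENNReal.ofReal (((2 ^ m) ^ ⌈|α|⌉₊)⁻¹ * C) :=
      eLpNorm_le_of_ae_bound (Filter.Eventually.of_forall fun x => by
        have h := hC m x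
        rwa [norm_iteratedFDeriv_zero] at h)
    have hfin : μ Set.univ ^ p.toReal⁻¹ ≠ ⊤ :=
      ENNReal.rpow_ne_top_of_nonneg (by positivity) (measure_ne_top _ _)
    have := ENNReal.toReal_mono (ENNReal.mul_ne_top hfin ENNReal.ofReal_ne_top) hb
    rwa [ENNReal.toReal_mul, ENNReal.toReal_ofReal (by positivity)] at this
  have h2 : (2 : ℝ) ^ (α * ((m : ℝ) - 1)) ≤ 2 ^ (-α) * (2 ^ m) ^ ⌈|α|⌉₊ := by
    rw [← pow_mul, ← Real.rpow_natCast, ← Real.rpow_add two_pos]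
    refine Real.rpow_le_rpow_of_exponent_le one_le_two ?_
    push_cast
    have h3 : α ≤ (⌈|α|⌉₊ : ℝ) := (le_abs_self α).trans (Nat.le_ceil _)
    nlinarith [(Nat.cast_nonneg m : (0 : ℝ) ≤ m)]
  have hV : 0 ≤ V := ENNReal.toReal_nonneg
  calc (2 : ℝ) ^ (α * ((m : ℝ) - 1)) * lpNorm p (block P m f)
      ≤ (2 ^ (-α) * (2 ^ m) ^ ⌈|α|⌉₊) * (V * (((2 ^ m) ^ ⌈|α|⌉₊)⁻¹ * C)) :=
        mul_le_mul h2 h1 ENNReal.toReal_nonneg (by positivity)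
    _ = 2 ^ (-α) * (V * C) := by
        field_simp

/-- `besovNorm` is a seminorm on `C^∞_per`. -/
noncomputable def besovSeminorm {d : ℕ} (P : LittlewoodPaley d) (α : ℝ) (p : ℝ≥0∞)
    [Fact (1 ≤ p)] : Seminorm ℂ (PerSmooth d) :=
  Seminorm.of (besovNorm P α p)
    (fun f g => by
      refine ciSup_le fun m => ?_
      refine le_trans ?_ (add_le_add (le_ciSup (bddAbove_besovNorm P α p f) m)
        (le_ciSup (bddAbove_besovNorm P α p g) m))
      rw [map_add, ← mul_add]
      gcongr
      exact lpNorm_add_le p _ _)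
    (fun c f => by
      unfold besovNorm
      rw [Real.mul_iSup_of_nonneg (norm_nonneg c)]
      simp only [map_smul, lpNorm_smul, mul_left_comm])

theorem mFourier_coe {d : ℕ} (n : Fin d → ℤ) (x : Fin d → ℝ) :
    UnitAddTorus.mFourier n (fun i => (x i : UnitAddCircle)) = character n x := by
  simp only [UnitAddTorus.mFourier, ContinuousMap.coe_mk, fourier_coe_apply, character,
    Complex.ofReal_one, div_one]
  rw [← Complex.exp_sum]
  congr 1
  push_cast
  rw [Finset.mul_sum]
  refine Finset.sum_congr rfl fun i _ => ?_
  ring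

theorem hasSum_fourier {d : ℕ} {f : (Fin d → ℝ) → ℂ} (hf : f ∈ PerSmooth d) (x : Fin d → ℝ) :
    HasSum (fun n => fourierCoeff f n * character n x) (f x) := by
  have hq : IsOpenQuotientMap (fun (x : Fin d → ℝ) (i : Fin d) => (x i : UnitAddCircle)) :=
    IsOpenQuotientMap.piMap fun _ => QuotientAddGroup.isOpenQuotientMap_mk
  have hfac : ∀ x y : Fin d → ℝ, (fun i => (x i : UnitAddCircle)) = (fun i => (y i : UnitAddCircle))
      → f x = f y := by
    intro x y hxy
    have h : ∀ i, ∃ k : ℤ, x i + k = y i := fun i => by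
      have h1 := congrFun hxy i
      obtain ⟨k, hk⟩ := AddSubgroup.mem_zmultiples_iff.1 (QuotientAddGroup.eq.1 h1)
      refine ⟨k, ?_⟩
      rw [zsmul_one] at hk
      linarith
    choose k hk using h
    rw [← hf.2 k x]
    congr 1
    funext i
    exact hk i
  let F : C(UnitAddTorus (Fin d), ℂ) :=
    Topology.IsQuotientMap.lift (f := ⟨_, hq.continuous⟩) hq.isQuotientMap
      ⟨f, hf.1.continuous⟩ fun x y => hfac x y
  have hF : ∀ x : Fin d → ℝ, F (fun i => (x i : UnitAddCircle)) = f x := fun x =>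
    DFunLike.congr_fun (Topology.IsQuotientMap.lift_comp (f := ⟨_, hq.continuous⟩)
      hq.isQuotientMap ⟨f, hf.1.continuous⟩ fun x y => hfac x y) x
  have hcoeff : ∀ n, UnitAddTorus.mFourierCoeff F n = fourierCoeff f n := by
    intro n
    rw [UnitAddTorus.mFourierCoeff_eq_integral F n 0]
    simp only [hF, mFourier_coe, smul_eq_mul]
    unfold fourierCoeff
    have e : {x : Fin d → ℝ | ∀ i, x i ∈ Set.Ioc ((0 : Fin d → ℝ) i) ((0 : Fin d → ℝ) i + 1)}
        = Set.univ.pi fun i => Set.Ioc ((0 : Fin d → ℝ) i) ((1 : Fin d → ℝ) i) := by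
      ext x; simp
    rw [e]
    exact setIntegral_congr_set Measure.univ_pi_Ioc_ae_eq_Icc
  have hs : Summable (UnitAddTorus.mFourierCoeff F) := by
    refine Summable.of_norm ?_
    simpa [hcoeff] using summable_pow_mul_fourierCoeff 0 hf
  have h := UnitAddTorus.hasSum_mFourier_series_apply_of_summable hs fun i => (x i : UnitAddCircle)
  simpa only [hF, hcoeff, mFourier_coe, smul_eq_mul] using h

theorem LittlewoodPaley.hasSum_cutoff {d : ℕ} (P : LittlewoodPaley d)
    (ζ : EuclideanSpace ℝ (Fin d)) : HasSum (fun m => P.cutoff m ζ) 1 := by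
  have hs : Summable fun k : ℕ => P.ann ((2 ^ k : ℝ)⁻¹ • ζ) := by
    obtain ⟨K, hK⟩ := pow_unbounded_of_one_lt (4 / 3 * ‖ζ‖) one_lt_two
    refine summable_of_ne_finset_zero (s := Finset.range K) fun k hk => ?_
    by_contra hne
    have h1 := (P.tsupport_ann (subset_tsupport _ hne)).2
    rw [mem_ball_zero_iff, not_lt, norm_smul, norm_inv, Real.norm_of_nonneg (by positivity),
      ← div_eq_inv_mul, le_div_iff₀ (by positivity)] at h1
    have h2 : (2 : ℝ) ^ K ≤ 2 ^ k :=
      pow_le_pow_right₀ one_le_two (by simpa using hk)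
    linarith
  have h := hs.hasSum.zero_add (f := fun m => P.cutoff m ζ)
  rwa [show P.cutoff 0 ζ = P.low ζ from rfl, P.sum_eq_one ζ] at h

theorem eq_zero_of_block_eq_zero {d : ℕ} (P : LittlewoodPaley d) (f : PerSmooth d)
    (h : ∀ m, block P m f = 0) : f = 0 := by
  ext x
  change (f : (Fin d → ℝ) → ℂ) x = 0
  set a : (Fin d → ℤ) → ℂ := fun n => fourierCoeff (f : (Fin d → ℝ) → ℂ) n * character n x
  have ha : Summable fun n => ‖a n‖ := by
    simpa only [a, norm_mul, norm_character, mul_one, pow_zero, one_mul] using summable_pow_mul_fourierCoeff 0 f.2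
  have hc : ∀ n, HasSum (fun m => (P.cutoff m (frequency n) : ℂ) * a n) (a n) := fun n => by
    have := (Complex.hasSum_ofReal.2 (P.hasSum_cutoff (frequency n))).mul_right (a n)
    simpa using this
  have hsum : Summable fun q : (Fin d → ℤ) × ℕ => (P.cutoff q.2 (frequency q.1) : ℂ) * a q.1 := by
    refine Summable.of_norm ((summable_prod_of_nonneg fun q => norm_nonneg _).2 ⟨fun n => ?_, ?_⟩)
    · exact (hc n).summable.norm
    · refine ha.congr fun n => ?_
      have := ((P.hasSum_cutoff (frequency n)).mul_right ‖a n‖).tsum_eq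
      rw [one_mul] at this
      rw [← this]
      refine tsum_congr fun m => ?_
      have h1 : ‖(P.cutoff m (frequency n) : ℂ)‖ = P.cutoff m (frequency n) := by
        rw [Complex.norm_real, Real.norm_of_nonneg (P.cutoff_mem m _).1]
      exact ((norm_mul _ (a n)).trans (by rw [h1])).symm
  rw [← (hasSum_fourier f.2 x).tsum_eq]
  calc ∑' n, a n = ∑' n, ∑' m, (P.cutoff m (frequency n) : ℂ) * a n :=
        tsum_congr fun n => (hc n).tsum_eq.symm
    _ = ∑' m, ∑' n, (P.cutoff m (frequency n) : ℂ) * a n :=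
        (Summable.tsum_comm (f := fun m n => (P.cutoff m (frequency n) : ℂ) * a n)
          hsum.prod_symm)
    _ = ∑' m : ℕ, (0 : ℂ) := by
        refine tsum_congr fun m => ?_
        have hm : blockFun P m f x = 0 := congrFun (congrArg Subtype.val (h m)) x
        rw [← hm]
        unfold blockFun
        exact tsum_congr fun n => by rw [smul_eq_mul, mul_assoc]
    _ = 0 := tsum_zero

theorem eq_zero_of_lpNorm_eq_zero {d : ℕ} (p : ℝ≥0∞) [hp : Fact (1 ≤ p)] (f : PerSmooth d)
    (h : lpNorm p f = 0) : f = 0 := by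
  have hm := memLp_perSmooth p f
  have h0 := ((ENNReal.toReal_eq_zero_iff _).1 h).resolve_right hm.2.ne
  rw [eLpNorm_eq_zero_iff hm.1 (zero_lt_one.trans_le hp.out).ne'] at h0
  have hU : Set.Icc (-1 : Fin d → ℝ) 1 ⊆ closure (interior (Set.Icc (-1 : Fin d → ℝ) 1)) := by
    rw [← Set.pi_univ_Icc, interior_pi_set Set.finite_univ, closure_pi_set]
    refine Set.pi_mono fun i _ => ?_
    rw [interior_Icc, closure_Ioo (by simp [neg_eq_iff_eq_neg]; norm_num)]
  have hE := Measure.eqOn_of_ae_eq h0 f.2.1.continuous.continuousOn continuousOn_const hU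
  ext x
  change (f : (Fin d → ℝ) → ℂ) x = 0
  rw [← f.2.2 (fun i => -⌊x i⌋) x]
  refine hE ⟨fun i => ?_, fun i => ?_⟩
  · have := Int.floor_le (x i)
    simp only [Pi.neg_apply, Pi.one_apply, Pi.add_apply]
    push_cast
    linarith
  · have := Int.lt_floor_add_one (x i)
    simp only [Pi.one_apply, Pi.add_apply]
    push_cast
    linarith

theorem eq_zero_of_besovNorm_eq_zero {d : ℕ} (P : LittlewoodPaley d) (α : ℝ) (p : ℝ≥0∞)
    [Fact (1 ≤ p)] (f : PerSmooth d) (h : besovNorm P α p f = 0) : f = 0 := by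
  refine eq_zero_of_block_eq_zero P f fun m => eq_zero_of_lpNorm_eq_zero p _ ?_
  have h1 := (le_ciSup (bddAbove_besovNorm P α p f) m).trans_eq h
  have h2 : (0 : ℝ) < 2 ^ (α * ((m : ℝ) - 1)) := by positivity
  exact le_antisymm (by nlinarith) ENNReal.toReal_nonneg

/-- The space `C^∞_per`, to be equipped with the norm of `B^α_{p,∞}`. -/
def BesovCore {d : ℕ} (_P : LittlewoodPaley d) (_α : ℝ) (_p : ℝ≥0∞) : Type :=
  PerSmooth d

noncomputable instance {d : ℕ} (P : LittlewoodPaley d) (α : ℝ) (p : ℝ≥0∞) [Fact (1 ≤ p)] :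
    NormedAddCommGroup (BesovCore P α p) :=
  AddGroupNorm.toNormedAddCommGroup (E := PerSmooth d)
    { (besovSeminorm P α p).toAddGroupSeminorm with
      eq_zero_of_map_eq_zero' := fun f h => eq_zero_of_besovNorm_eq_zero P α p f h }

noncomputable instance {d : ℕ} (P : LittlewoodPaley d) (α : ℝ) (p : ℝ≥0∞) [Fact (1 ≤ p)] :
    NormedSpace ℂ (BesovCore P α p) :=
  { (inferInstance : Module ℂ (PerSmooth d)) with
    norm_smul_le := fun c f => (map_smul_eq_mul (besovSeminorm P α p) c f).le }

/-- The Besov space `B^α_{p,∞}`: the completion of `C^∞_per` for the norm `besovNorm P α p`. -/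
abbrev Besov {d : ℕ} (P : LittlewoodPaley d) (α : ℝ) (p : ℝ≥0∞) [Fact (1 ≤ p)] : Type :=
  UniformSpace.Completion (BesovCore P α p)

/-- The canonical dense embedding of `C^∞_per` into `B^α_{p,∞}`. -/
noncomputable def toBesov {d : ℕ} (P : LittlewoodPaley d) (α : ℝ) (p : ℝ≥0∞) [Fact (1 ≤ p)]
    (f : PerSmooth d) : Besov P α p :=
  UniformSpace.Completion.coe' (α := BesovCore P α p) f

theorem norm_toBesov {d : ℕ} (P : LittlewoodPaley d) (α : ℝ) (p : ℝ≥0∞) [Fact (1 ≤ p)]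
    (f : PerSmooth d) : ‖toBesov P α p f‖ = besovNorm P α p f :=
  UniformSpace.Completion.norm_coe (E := BesovCore P α p) f

end BesovTorus
open BesovTorus

namespace BesovTorus

/-! Put a = 2^(-α), b = 2^(-β), c = 2^(-γ), and index blocks so that δ_i lives at frequencies of
order 2^i. Finite Besov norms mean that the blocks of f, g, h are O(a^i), O(b^i), O(c^i) in their
L^p spaces, and the hypotheses read 2a > 1, bc > 1, abc < 1; in particular a < 1. The commutator is
the sum over |i-k| ≤ 1 of D_i δ_k h, where D_i = δ_i(f ≺ g) - f δ_i g is `paraDefect`.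

The gain is in D_i. By spectral supports only blocks δ_l g with l close to i contribute. With S the
sum of the δ_j f over j < l-1 (`lowSum`), D_i is the sum over these l of [δ_i, S] δ_l g - (f - S)
δ_i δ_l g. Since δ_i averages translates over distances of order 2^(-i), the commutator [δ_i, S]
costs 2^(-i) times the L^p Lipschitz constant of S (`exists_lpNorm_commutator_mul_le`), and that
constant is O((2a)^i) because 2a > 1. The tail f - S is O(a^i) because a < 1. Hence D_i δ_k h is
O((abc)^i): this is `exists_lpNorm_paraDefect_mul_le`.

It remains to estimate δ_r of the sum. The indices i ≥ r-5 contribute a geometric series in abc < 1,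
of size (abc)^r. For smaller i the product D_i δ_k h is not frequency localised, since f is not; but
every part of it built from low frequencies of f is annihilated by δ_r, and what is left is -(f - S)
δ_i g δ_k h with S the low frequencies of f up to about 2^r (`block_paraDefect_mul_eq`). It has size
a^r (bc)^i, and as bc > 1 the sum over i ≤ r is again O((abc)^r).

All constants are uniform over smooth f, g, h, so the map extends from the dense subspaces by
continuity, one variable at a time. -/

/-! ### Sup and Lipschitz bounds for periodic functions, and their translates -/

theorem exists_norm_le_of_periodic {d : ℕ} {E : Type*} [NormedAddCommGroup E]
    {f : (Fin d → ℝ) → E} (hc : Continuous f)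
    (hper : ∀ (n : Fin d → ℤ) (x : Fin d → ℝ), f (x + fun i => (n i : ℝ)) = f x) :
    ∃ C : ℝ, ∀ x, ‖f x‖ ≤ C := by
  obtain ⟨C, hC⟩ := isCompact_Icc.exists_bound_of_continuousOn
    (hc.continuousOn (s := Set.Icc (0 : Fin d → ℝ) 1))
  refine ⟨C, fun x => ?_⟩
  rw [← hper (fun i => -⌊x i⌋) x]
  refine hC _ ⟨fun i => ?_, fun i => ?_⟩
  · have := Int.floor_le (x i)
    simp only [Pi.zero_apply, Pi.add_apply]
    push_cast
    linarith
  · have := Int.lt_floor_add_one (x i)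
    simp only [Pi.one_apply, Pi.add_apply]
    push_cast
    linarith

theorem exists_norm_le {d : ℕ} (f : PerSmooth d) :
    ∃ C : ℝ, ∀ x, ‖(f : (Fin d → ℝ) → ℂ) x‖ ≤ C :=
  exists_norm_le_of_periodic f.2.1.continuous f.2.2

theorem exists_lipschitz {d : ℕ} (f : PerSmooth d) :
    ∃ C : ℝ, 0 ≤ C ∧ ∀ x y, ‖(f : (Fin d → ℝ) → ℂ) x - (f : (Fin d → ℝ) → ℂ) y‖ ≤ C * ‖x - y‖ := by
  have hp : ∀ (n : Fin d → ℤ) (x : Fin d → ℝ),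
      fderiv ℝ (f : (Fin d → ℝ) → ℂ) (x + fun i => (n i : ℝ)) = fderiv ℝ (f : (Fin d → ℝ) → ℂ) x := by
    intro n x
    have h : (fun y => (f : (Fin d → ℝ) → ℂ) (y + fun i => (n i : ℝ))) = f :=
      funext fun y => f.2.2 n y
    rw [← fderiv_comp_add_right, h]
  obtain ⟨C, hC⟩ := exists_norm_le_of_periodic (f.2.1.continuous_fderiv (by simp)) hp
  refine ⟨C, (norm_nonneg _).trans (hC 0), fun x y => ?_⟩
  exact Convex.norm_image_sub_le_of_norm_fderiv_le (s := Set.univ)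
    (fun z _ => f.2.1.differentiable (by simp) z) (fun z _ => hC z) convex_univ
    (Set.mem_univ y) (Set.mem_univ x)

/-- A smooth periodic function as a bounded continuous function. -/
noncomputable def toBCF {d : ℕ} (f : PerSmooth d) : BoundedContinuousFunction (Fin d → ℝ) ℂ :=
  BoundedContinuousFunction.ofNormedAddCommGroup (f : (Fin d → ℝ) → ℂ) f.2.1.continuous
    (exists_norm_le f).choose (exists_norm_le f).choose_spec

@[simp]
theorem toBCF_apply {d : ℕ} (f : PerSmooth d) (x : Fin d → ℝ) :
    toBCF f x = (f : (Fin d → ℝ) → ℂ) x := rfl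

/-- The translate `x ↦ f (x - t)`. -/
noncomputable def translate {d : ℕ} (t : Fin d → ℝ) (f : PerSmooth d) : PerSmooth d :=
  ⟨fun x => (f : (Fin d → ℝ) → ℂ) (x - t), f.2.1.comp (contDiff_id.sub contDiff_const),
    fun n x => by
      have : x + (fun i => (n i : ℝ)) - t = (x - t) + fun i => (n i : ℝ) := by abel
      simp only [this, f.2.2]⟩

@[simp]
theorem translate_apply {d : ℕ} (t : Fin d → ℝ) (f : PerSmooth d) (x : Fin d → ℝ) :
    (translate t f : (Fin d → ℝ) → ℂ) x = (f : (Fin d → ℝ) → ℂ) (x - t) := rfl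

/-- Makes families of translates strongly measurable with values in the bounded continuous
functions, as the Bochner integrals below require. In L^∞ modulo null sets, continuity of
translation would fail for general functions; here it follows from the Lipschitz bound. -/
theorem continuous_toBCF_translate {d : ℕ} (f : PerSmooth d) :
    Continuous fun t => toBCF (translate t f) := by
  obtain ⟨C, hC0, hC⟩ := exists_lipschitz f
  refine (LipschitzWith.of_dist_le_mul (K := ⟨C, hC0⟩) fun s t => ?_).continuous
  refine (BoundedContinuousFunction.dist_le (mul_nonneg hC0 dist_nonneg)).2 fun x => ?_
  rw [dist_eq_norm, dist_eq_norm]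
  refine (hC _ _).trans_eq ?_
  rw [show x - s - (x - t) = -(s - t) by abel, norm_neg]

theorem norm_toBCF_translate_le {d : ℕ} (t : Fin d → ℝ) (f : PerSmooth d) :
    ‖toBCF (translate t f)‖ ≤ ‖toBCF f‖ :=
  (BoundedContinuousFunction.norm_le (norm_nonneg _)).2 fun x => (toBCF f).norm_coe_le_norm (x - t)

/-! ### The L^p norm on the cube and Minkowski's inequality -/

/-- The measure defining `lpNorm`. -/
noncomputable def cubeMeasure (d : ℕ) : Measure (Fin d → ℝ) :=
  volume.restrict (Set.Icc (-1 : Fin d → ℝ) 1)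

instance (d : ℕ) : IsFiniteMeasure (cubeMeasure d) :=
  isFiniteMeasure_restrict.2 isCompact_Icc.measure_lt_top.ne

/-- Presents `lpNorm` as a norm after a continuous linear map, so that it can be pushed through
vector-valued integrals for every p, including p = ∞. -/
theorem norm_toLp_toBCF {d : ℕ} (p : ℝ≥0∞) [Fact (1 ≤ p)] (f : PerSmooth d) :
    ‖BoundedContinuousFunction.toLp p (cubeMeasure d) ℂ (toBCF f)‖ = lpNorm p f := by
  rw [Lp.norm_def, eLpNorm_congr_ae (BoundedContinuousFunction.coeFn_toLp p (cubeMeasure d) ℂ _)]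
  rfl

theorem lpNorm_nonneg {d : ℕ} (p : ℝ≥0∞) (f : PerSmooth d) : 0 ≤ lpNorm p f :=
  ENNReal.toReal_nonneg

theorem lpNorm_zero {d : ℕ} (p : ℝ≥0∞) : lpNorm p (0 : PerSmooth d) = 0 := by
  have := lpNorm_smul p 0 (0 : PerSmooth d)
  simpa using this

theorem lpNorm_neg {d : ℕ} (p : ℝ≥0∞) (f : PerSmooth d) : lpNorm p (-f) = lpNorm p f := by
  have := lpNorm_smul p (-1) f
  simpa using this

theorem lpNorm_sub_le {d : ℕ} (p : ℝ≥0∞) [Fact (1 ≤ p)] (f g : PerSmooth d) :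
    lpNorm p (f - g) ≤ lpNorm p f + lpNorm p g := by
  rw [sub_eq_add_neg, ← lpNorm_neg p g]
  exact lpNorm_add_le p f (-g)

theorem lpNorm_sum_le {d : ℕ} (p : ℝ≥0∞) [Fact (1 ≤ p)] {ι : Type*} (s : Finset ι)
    (f : ι → PerSmooth d) : lpNorm p (∑ i ∈ s, f i) ≤ ∑ i ∈ s, lpNorm p (f i) :=
  Finset.le_sum_of_subadditive _ (lpNorm_zero p).le (lpNorm_add_le p) s f

theorem exists_lpNorm_le_sup (d : ℕ) (p : ℝ≥0∞) [Fact (1 ≤ p)] :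
    ∃ V : ℝ, 0 ≤ V ∧ ∀ (f : PerSmooth d) (M : ℝ), 0 ≤ M →
      (∀ x, ‖(f : (Fin d → ℝ) → ℂ) x‖ ≤ M) → lpNorm p f ≤ V * M := by
  refine ⟨‖BoundedContinuousFunction.toLp (E := ℂ) p (cubeMeasure d) ℂ‖, norm_nonneg _,
    fun f M hM0 hM => ?_⟩
  rw [← norm_toLp_toBCF]
  refine (ContinuousLinearMap.le_opNorm _ _).trans ?_
  gcongr
  exact (BoundedContinuousFunction.norm_le hM0).2 hM

/-- Minkowski's integral inequality for smooth periodic functions. -/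
theorem lpNorm_le_integral {d : ℕ} (p : ℝ≥0∞) [Fact (1 ≤ p)] {Y : Type*} [TopologicalSpace Y]
    [SecondCountableTopology Y] [MeasurableSpace Y] [OpensMeasurableSpace Y] {ν : Measure Y}
    {w : Y → ℂ} (hw : Integrable w ν) {G : Y → PerSmooth d}
    (hG : Continuous fun y => toBCF (G y)) {M : ℝ} (hM : ∀ y, ‖toBCF (G y)‖ ≤ M)
    {F : PerSmooth d}
    (hF : ∀ x, (F : (Fin d → ℝ) → ℂ) x = ∫ y, w y * (G y : (Fin d → ℝ) → ℂ) x ∂ν) :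
    lpNorm p F ≤ ∫ y, ‖w y‖ * lpNorm p (G y) ∂ν := by
  -- The integral is taken in the sup norm, where point evaluations are continuous; this identifies
  -- its value with F. Only afterwards is it mapped to L^p.
  have hint : Integrable (fun y => w y • toBCF (G y)) ν := by
    refine (hw.norm.mul_const M).mono' (hw.1.smul hG.aestronglyMeasurable)
      (Filter.Eventually.of_forall fun y => ?_)
    rw [norm_smul]
    gcongr
    exact hM y
  have hE : toBCF F = ∫ y, w y • toBCF (G y) ∂ν := by
    ext x
    have := (BoundedContinuousFunction.evalCLM ℂ x).integral_comp_comm hint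
    simp only [BoundedContinuousFunction.evalCLM_apply] at this
    rw [← this, toBCF_apply, hF]
    rfl
  rw [← norm_toLp_toBCF, hE, ← ContinuousLinearMap.integral_comp_comm _ hint]
  refine (norm_integral_le_integral_norm _).trans_eq ?_
  refine integral_congr_ae (Filter.Eventually.of_forall fun y => ?_)
  simp only [map_smul, norm_smul, norm_toLp_toBCF]

/-! ### Translation invariance of the L^p norm -/

open scoped Pointwise in
theorem exists_isAddFundamentalDomain (d : ℕ) : ∃ Λ : Submodule ℤ (Fin d → ℝ), Countable Λ ∧
    (∀ g ∈ Λ, ∃ n : Fin d → ℤ, g = fun i => (n i : ℝ)) ∧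
    IsAddFundamentalDomain Λ (Set.univ.pi fun _ : Fin d => Set.Ico (-1 : ℝ) 1) volume := by
  let b : Module.Basis (Fin d) ℝ (Fin d → ℝ) :=
    (Pi.basisFun ℝ (Fin d)).unitsSMul fun _ => Units.mk0 (2 : ℝ) two_ne_zero
  have hrepr : ∀ x i, b.repr x i = x i / 2 := fun x i => by
    simp [b, Module.Basis.repr_unitsSMul, Units.smul_def]
    ring
  refine ⟨Submodule.span ℤ (Set.range b), inferInstance, fun g hg => ?_, ?_⟩
  · induction hg using Submodule.span_induction with
    | mem g h =>
      obtain ⟨i, rfl⟩ := h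
      refine ⟨Pi.single i 2, ?_⟩
      ext j
      simp [b, Module.Basis.unitsSMul_apply, Units.smul_def, Pi.single_apply]
    | zero => exact ⟨0, by ext; simp⟩
    | add x y _ _ hx hy =>
      obtain ⟨n, rfl⟩ := hx
      obtain ⟨m, rfl⟩ := hy
      exact ⟨n + m, by ext; simp⟩
    | smul a x _ hx =>
      obtain ⟨n, rfl⟩ := hx
      exact ⟨a • n, by ext; simp⟩
  -- The lattice is 2ℤ^d, a sublattice of the periods; its standard fundamental domain [0,2)^d is
  -- shifted by -1 to match the cube in `lpNorm`.
  · have h := (ZSpan.isAddFundamentalDomain b volume).vadd_of_comm (-1 : Fin d → ℝ)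
    suffices e : (Set.univ.pi fun _ : Fin d => Set.Ico (-1 : ℝ) 1)
        = (-1 : Fin d → ℝ) +ᵥ ZSpan.fundamentalDomain b by
      rw [e]
      exact h
    ext x
    rw [Set.mem_vadd_set_iff_neg_vadd_mem]
    simp only [ZSpan.fundamentalDomain, hrepr, Set.mem_ofPred_eq, Set.mem_pi, Set.mem_univ,
      true_imp_iff, Set.mem_Ico, neg_neg, vadd_eq_add, Pi.add_apply, Pi.one_apply]
    refine forall_congr' fun i => ?_
    constructor
    · intro ⟨h1, h2⟩
      constructor <;> linarith
    · intro ⟨h1, h2⟩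
      constructor <;> linarith

theorem cubeMeasure_eq (d : ℕ) :
    cubeMeasure d = volume.restrict (Set.univ.pi fun _ : Fin d => Set.Ico (-1 : ℝ) 1) := by
  unfold cubeMeasure
  refine (Measure.restrict_congr_set ?_).symm
  exact Measure.univ_pi_Ico_ae_eq_Icc (f := (-1 : Fin d → ℝ)) (g := 1)

open scoped Pointwise in
theorem lpNorm_translate {d : ℕ} (p : ℝ≥0∞) (t : Fin d → ℝ) (f : PerSmooth d) :
    lpNorm p (translate t f) = lpNorm p f := by
  obtain ⟨Λ, hc, hΛ, hD⟩ := exists_isAddFundamentalDomain d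
  have : VAddInvariantMeasure Λ (Fin d → ℝ) volume :=
    ⟨fun g s _ => measure_preimage_add volume (g : Fin d → ℝ) s⟩
  set D := Set.univ.pi fun _ : Fin d => Set.Ico (-1 : ℝ) 1
  have hinv : ∀ (f : PerSmooth d) (g : Λ) (x : Fin d → ℝ),
      (f : (Fin d → ℝ) → ℂ) (g +ᵥ x) = (f : (Fin d → ℝ) → ℂ) x := fun f g x => by
    obtain ⟨n, hn⟩ := hΛ g g.2
    rw [Submodule.vadd_def, vadd_eq_add, hn, add_comm, f.2.2]
  change ENNReal.toReal (eLpNorm _ p (cubeMeasure d)) = ENNReal.toReal (eLpNorm _ p (cubeMeasure d))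
  rw [cubeMeasure_eq]
  congr 1
  rcases eq_or_ne p 0 with rfl | h0
  · simp
  rcases eq_or_ne p ⊤ with rfl | htop
  · simp only [eLpNorm_exponent_top, eLpNormEssSup]
    -- For an invariant function the essential supremum over a fundamental domain is the one over
    -- the whole space, where translation preserves the measure.
    rw [hD.essSup_measure_restrict fun g x => by rw [hinv],
      hD.essSup_measure_restrict fun g x => by rw [hinv]]
    have hmp := measurePreserving_sub_right (volume : Measure (Fin d → ℝ)) t
    conv_rhs => rw [← hmp.map_eq]
    rw [essSup_map_measure (f.2.1.continuous.enorm.measurable.aemeasurable) hmp.aemeasurable]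
    rfl
  · rw [eLpNorm_eq_lintegral_rpow_enorm_toReal h0 htop,
      eLpNorm_eq_lintegral_rpow_enorm_toReal h0 htop]
    congr 1
    have hmp := measurePreserving_sub_right (volume : Measure (Fin d → ℝ)) t
    have he : MeasurableEmbedding fun x : Fin d → ℝ => x - t :=
      (Homeomorph.subRight t).measurableEmbedding
    -- A translate of a fundamental domain is again one, so an invariant integrand has the same
    -- integral over D and over -t + D.
    have h2 := hD.vadd_of_comm (-t)
    rw [hD.setLIntegral_eq h2 (fun x => ‖(f : (Fin d → ℝ) → ℂ) x‖ₑ ^ p.toReal)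
      fun g x => by rw [hinv]]
    rw [← hmp.setLIntegral_comp_preimage_emb he
      (fun x => ‖(f : (Fin d → ℝ) → ℂ) x‖ₑ ^ p.toReal)]
    have e : (fun x : Fin d → ℝ => x - t) ⁻¹' (-t +ᵥ D) = D := by
      ext x
      rw [Set.mem_preimage, Set.mem_vadd_set_iff_neg_vadd_mem]
      simp
    rw [e]
    rfl

/-! ### Littlewood-Paley blocks as convolutions with Schwartz kernels -/

open scoped FourierTransform SchwartzMap in
-- ψ is the inverse Fourier transform of v ↦ φ(2πv). The dilation by 2π reconciles the transform
-- with kernel exp(-2πi y·v) with cutoffs evaluated at the frequencies 2πn.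
theorem exists_schwartz_fourier {d : ℕ} {φ : EuclideanSpace ℝ (Fin d) → ℝ} (hφ : ContDiff ℝ ∞ φ)
    (hs : HasCompactSupport φ) : ∃ ψ : 𝓢(EuclideanSpace ℝ (Fin d), ℂ), ∀ v,
      ∫ y, Complex.exp (((-2 * Real.pi * inner ℝ y v : ℝ) : ℂ) * Complex.I) * ψ y
        = φ ((2 * Real.pi) • v) := by
  have h2 : (2 * Real.pi : ℝ) ≠ 0 := by positivity
  have hd : ContDiff ℝ ∞ fun v => (φ ((2 * Real.pi) • v) : ℂ) :=
    Complex.ofRealCLM.contDiff.comp (hφ.comp (contDiff_const_smul _))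
  have hc : HasCompactSupport fun v => (φ ((2 * Real.pi) • v) : ℂ) :=
    (hs.comp_smul h2).comp_left (g := fun r : ℝ => (r : ℂ)) Complex.ofReal_zero
  refine ⟨𝓕⁻ (hc.toSchwartzMap hd), fun v => ?_⟩
  have h := congrFun (congrArg DFunLike.coe
    (FourierTransform.fourier_fourierInv_eq (E := 𝓢(EuclideanSpace ℝ (Fin d), ℂ))
      (F := 𝓢(EuclideanSpace ℝ (Fin d), ℂ)) (hc.toSchwartzMap hd))) v
  rw [SchwartzMap.fourier_coe, Real.fourier_eq'] at h
  exact h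

theorem LittlewoodPaley.hasCompactSupport_low {d : ℕ} (P : LittlewoodPaley d) :
    HasCompactSupport P.low :=
  (isCompact_closedBall (0 : EuclideanSpace ℝ (Fin d)) (4 / 3)).of_isClosed_subset
    (isClosed_tsupport _) (P.tsupport_low.trans Metric.ball_subset_closedBall)

theorem LittlewoodPaley.hasCompactSupport_ann {d : ℕ} (P : LittlewoodPaley d) :
    HasCompactSupport P.ann :=
  (isCompact_closedBall (0 : EuclideanSpace ℝ (Fin d)) (8 / 3)).of_isClosed_subset
    (isClosed_tsupport _) ((P.tsupport_ann.trans Set.sdiff_subset).trans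
      Metric.ball_subset_closedBall)

open scoped SchwartzMap in
/-- The Schwartz functions whose Fourier transforms are `low` and `ann`. -/
noncomputable def LittlewoodPaley.kernel {d : ℕ} (P : LittlewoodPaley d) :
    ℕ → 𝓢(EuclideanSpace ℝ (Fin d), ℂ)
  | 0 => (exists_schwartz_fourier P.contDiff_low P.hasCompactSupport_low).choose
  | _ + 1 => (exists_schwartz_fourier P.contDiff_ann P.hasCompactSupport_ann).choose

/-- The length scale `2^{-(m-1)}` of the `m`-th cutoff, equal to `1` if `m = 0`. -/
noncomputable def scale : ℕ → ℝ
  | 0 => 1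
  | k + 1 => (2 ^ k)⁻¹

theorem scale_pos (m : ℕ) : 0 < scale m := by
  cases m <;> simp [scale]

theorem scale_le (m : ℕ) : scale m ≤ 2 * (2 ^ m)⁻¹ := by
  cases m with
  | zero => simp [scale]
  | succ k => simp [scale, pow_succ]

theorem scale_inv_le (m : ℕ) : (scale m)⁻¹ ≤ 2 ^ m := by
  cases m with
  | zero => simp [scale]
  | succ k =>
    simp only [scale, inv_inv, pow_succ]
    linarith [pow_pos (two_pos : (0 : ℝ) < 2) k]

theorem LittlewoodPaley.integral_kernel {d : ℕ} (P : LittlewoodPaley d) (m : ℕ)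
    (v : EuclideanSpace ℝ (Fin d)) :
    ∫ y, Complex.exp (((-2 * Real.pi * inner ℝ y (scale m • v) : ℝ) : ℂ) * Complex.I) *
      P.kernel m y = P.cutoff m ((2 * Real.pi) • v) := by
  cases m with
  | zero =>
    rw [LittlewoodPaley.kernel,
      (exists_schwartz_fourier P.contDiff_low P.hasCompactSupport_low).choose_spec]
    simp [scale, LittlewoodPaley.cutoff]
  | succ k =>
    rw [LittlewoodPaley.kernel,
      (exists_schwartz_fourier P.contDiff_ann P.hasCompactSupport_ann).choose_spec]
    simp only [scale, LittlewoodPaley.cutoff]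
    rw [smul_comm]

theorem LittlewoodPaley.integrable_kernel {d : ℕ} (P : LittlewoodPaley d) (m : ℕ) :
    Integrable (P.kernel m) := (P.kernel m).integrable

theorem character_sub_smul {d : ℕ} (n : Fin d → ℤ) (x : Fin d → ℝ) (s : ℝ)
    (y : EuclideanSpace ℝ (Fin d)) :
    character n (x - s • y.ofLp) = character n x *
      Complex.exp (((-2 * Real.pi * inner ℝ y (s • WithLp.toLp 2 fun i => (n i : ℝ)) : ℝ) : ℂ)
        * Complex.I) := by
  unfold character
  rw [← Complex.exp_add]
  congr 1
  simp only [PiLp.inner_apply, Pi.sub_apply, Pi.smul_apply, PiLp.smul_apply, smul_eq_mul,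
    RCLike.inner_apply, conj_trivial, mul_sub, Finset.sum_sub_distrib]
  push_cast
  have : ∑ i, (s : ℂ) * (n i : ℂ) * (y i : ℂ) = ∑ i, (n i : ℂ) * (s * y i) :=
    Finset.sum_congr rfl fun i _ => by ring
  rw [this]
  ring

theorem norm_fourierCoeff_summable {d : ℕ} (f : PerSmooth d) :
    Summable fun n => ‖fourierCoeff (f : (Fin d → ℝ) → ℂ) n‖ := by
  simpa using summable_pow_mul_fourierCoeff 0 f.2

/-- Littlewood-Paley blocks are averages of translates against a rescaled Schwartz kernel. -/
theorem block_eq_integral {d : ℕ} (P : LittlewoodPaley d) (m : ℕ) (f : PerSmooth d)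
    (x : Fin d → ℝ) : (block P m f : (Fin d → ℝ) → ℂ) x =
      ∫ y, P.kernel m y * (f : (Fin d → ℝ) → ℂ) (x - scale m • y.ofLp) := by
  have hchar : ∀ n, Continuous fun y : EuclideanSpace ℝ (Fin d) =>
      character n (x - scale m • y.ofLp) := fun n =>
    (character_mem n).1.continuous.comp (by fun_prop)
  have hn : ∀ (n : Fin d → ℤ) (y : EuclideanSpace ℝ (Fin d)), ‖P.kernel m y *
      (fourierCoeff (f : (Fin d → ℝ) → ℂ) n * character n (x - scale m • y.ofLp))‖
        = ‖P.kernel m y‖ * ‖fourierCoeff (f : (Fin d → ℝ) → ℂ) n‖ := fun n y => by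
    rw [norm_mul, norm_mul, norm_character, mul_one]
  -- Expand f in its absolutely convergent Fourier series and exchange sum and integral, without
  -- periodising the kernel.
  have hsum := hasSum_integral_of_summable_integral_norm
    (F := fun (n : Fin d → ℤ) (y : EuclideanSpace ℝ (Fin d)) => P.kernel m y *
      (fourierCoeff (f : (Fin d → ℝ) → ℂ) n * character n (x - scale m • y.ofLp)))
    (μ := volume)
    (fun n => by
      refine ((P.integrable_kernel m).norm.mul_const _).mono'
        ((P.integrable_kernel m).1.mul
          (continuous_const.mul (hchar n)).aestronglyMeasurable)
        (Filter.Eventually.of_forall fun y => (hn n y).le))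
    (by
      simp only [hn, integral_mul_const]
      exact (norm_fourierCoeff_summable f).mul_left _)
  have h1 : ∀ y : EuclideanSpace ℝ (Fin d), ∑' n, P.kernel m y *
      (fourierCoeff (f : (Fin d → ℝ) → ℂ) n * character n (x - scale m • y.ofLp))
        = P.kernel m y * (f : (Fin d → ℝ) → ℂ) (x - scale m • y.ofLp) := fun y =>
    ((hasSum_fourier f.2 _).mul_left _).tsum_eq
  simp only [h1] at hsum
  rw [← hsum.tsum_eq]
  change blockFun P m f x = _
  unfold blockFun
  refine tsum_congr fun n => ?_
  -- Each character is an eigenfunction of the averaging operator, with the cutoff at its frequency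
  -- as eigenvalue.
  have h2 := P.integral_kernel m (WithLp.toLp 2 fun i => (n i : ℝ))
  have h3 : (2 * Real.pi) • (WithLp.toLp 2 fun i => (n i : ℝ)) = frequency n := rfl
  rw [h3] at h2
  rw [← h2, smul_eq_mul, mul_assoc, ← integral_mul_const]
  refine integral_congr_ae (Filter.Eventually.of_forall fun y => ?_)
  simp only [character_sub_smul]
  ring

/-! ### Kernel estimates: boundedness, increments and commutators of blocks -/

/-- Write the increment as an integral of the derivative along the segment from y to y - s, exchange
the two integrations by Tonelli, and use translation invariance for each point of the segment.
Extended nonnegative integrals avoid any integrability check on the double integral. -/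
theorem integral_norm_translate_sub_le {E : Type*} [NormedAddCommGroup E] [InnerProductSpace ℝ E]
    [FiniteDimensional ℝ E] [MeasurableSpace E] [BorelSpace E] (ψ : SchwartzMap E ℂ) (s : E) :
    ∫ y, ‖ψ (y - s) - ψ y‖ ≤ ‖s‖ * ∫ y, ‖fderiv ℝ ψ y‖ := by
  have hD : Integrable fun y => fderiv ℝ ψ y := (SchwartzMap.fderivCLM ℝ E ℂ ψ).integrable
  have hDc : Continuous fun y => fderiv ℝ ψ y := (SchwartzMap.fderivCLM ℝ E ℂ ψ).continuous
  have hpt : ∀ y, ‖ψ (y - s) - ψ y‖ₑ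
      ≤ ∫⁻ θ in Set.Icc (0 : ℝ) 1, ‖s‖ₑ * ‖fderiv ℝ ψ (y - θ • s)‖ₑ := by
    intro y
    have h1 : ∀ θ : ℝ, HasDerivAt (fun θ : ℝ => ψ (y - θ • s)) (-(fderiv ℝ ψ (y - θ • s) s)) θ := by
      intro θ
      have h2 : HasDerivAt (fun θ : ℝ => y - θ • s) (-s) θ := by
        simpa using ((hasDerivAt_id θ).smul_const s).const_sub y
      have := ((ψ.differentiableAt (x := y - θ • s)).hasFDerivAt).comp_hasDerivAt θ h2
      rw [map_neg] at this
      exact this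
    have hcont : Continuous fun θ : ℝ => -(fderiv ℝ ψ (y - θ • s) s) :=
      ((hDc.comp (by fun_prop)).clm_apply continuous_const).neg
    have h3 := intervalIntegral.integral_eq_sub_of_hasDerivAt (a := 0) (b := 1)
      (fun θ _ => h1 θ) (hcont.intervalIntegrable 0 1)
    simp only [one_smul, zero_smul, sub_zero] at h3
    rw [← h3, intervalIntegral.integral_of_le zero_le_one]
    refine (enorm_integral_le_lintegral_enorm _).trans ?_
    refine (lintegral_mono' (Measure.restrict_mono Set.Ioc_subset_Icc_self le_rfl) le_rfl).trans ?_
    refine lintegral_mono fun θ => ?_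
    rw [enorm_neg, mul_comm]
    exact ContinuousLinearMap.le_opENorm _ _
  have hmeas : Measurable (Function.uncurry fun (y : E) (θ : ℝ) =>
      ‖s‖ₑ * ‖fderiv ℝ ψ (y - θ • s)‖ₑ) := by
    have : Continuous (Function.uncurry fun (y : E) (θ : ℝ) => fderiv ℝ ψ (y - θ • s)) :=
      hDc.comp (by fun_prop)
    exact measurable_const.mul this.enorm.measurable
  have key : ∫⁻ y, ‖ψ (y - s) - ψ y‖ₑ ≤ ‖s‖ₑ * ∫⁻ y, ‖fderiv ℝ ψ y‖ₑ := by
    calc ∫⁻ y, ‖ψ (y - s) - ψ y‖ₑ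
        ≤ ∫⁻ y, ∫⁻ θ in Set.Icc (0 : ℝ) 1, ‖s‖ₑ * ‖fderiv ℝ ψ (y - θ • s)‖ₑ :=
          lintegral_mono hpt
      _ = ∫⁻ θ in Set.Icc (0 : ℝ) 1, ∫⁻ y, ‖s‖ₑ * ‖fderiv ℝ ψ (y - θ • s)‖ₑ :=
          lintegral_lintegral_swap hmeas.aemeasurable
      _ = ∫⁻ θ in Set.Icc (0 : ℝ) 1, ‖s‖ₑ * ∫⁻ y, ‖fderiv ℝ ψ y‖ₑ := by
          refine lintegral_congr fun θ => ?_
          have hc : Continuous fun y => fderiv ℝ ψ (y - θ • s) := hDc.comp (by fun_prop)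
          rw [lintegral_const_mul _ hc.enorm.measurable]
          congr 1
          exact lintegral_sub_right_eq_self (fun y => ‖fderiv ℝ ψ y‖ₑ) (θ • s)
      _ = _ := by simp
  have hi : Integrable fun y => ψ (y - s) - ψ y :=
    (ψ.integrable.comp_sub_right s).sub ψ.integrable
  rw [integral_norm_eq_lintegral_enorm hi.1, integral_norm_eq_lintegral_enorm hD.1, ← toReal_enorm,
    ← ENNReal.toReal_mul]
  exact ENNReal.toReal_mono (ENNReal.mul_ne_top (by simp) hD.2.ne) key

/-- The three integrals control, in turn, boundedness of blocks, commutators and increments. -/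
theorem exists_integral_kernel_le {d : ℕ} (P : LittlewoodPaley d) : ∃ C : ℝ, 0 ≤ C ∧ ∀ m : ℕ,
    ∫ y, ‖P.kernel m y‖ ≤ C ∧ ∫ y, ‖P.kernel m y‖ * ‖y‖ ≤ C ∧
      ∫ y, ‖fderiv ℝ (P.kernel m) y‖ ≤ C := by
  let A := fun m => (∫ y, ‖P.kernel m y‖) + (∫ y, ‖P.kernel m y‖ * ‖y‖) +
    ∫ y, ‖fderiv ℝ (P.kernel m) y‖
  have h1 : ∀ m, 0 ≤ ∫ y, ‖P.kernel m y‖ := fun m => integral_nonneg fun _ => norm_nonneg _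
  have h2 : ∀ m, 0 ≤ ∫ y, ‖P.kernel m y‖ * ‖y‖ := fun m => integral_nonneg fun _ => by positivity
  have h3 : ∀ m, 0 ≤ ∫ y, ‖fderiv ℝ (P.kernel m) y‖ := fun m =>
    integral_nonneg fun _ => norm_nonneg _
  have hA : ∀ m, 0 ≤ A m := fun m => add_nonneg (add_nonneg (h1 m) (h2 m)) (h3 m)
  have hle : ∀ m, A m ≤ A 0 + A 1 := fun m => by
    cases m with
    | zero => linarith [hA 1]
    -- All kernels of positive index are one and the same function, the dilation being carried by
    -- `scale`; hence two constants bound them all.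
    | succ k => exact le_add_of_nonneg_left (hA 0)
  refine ⟨A 0 + A 1, add_nonneg (hA 0) (hA 1), fun m => ⟨?_, ?_, ?_⟩⟩ <;>
    refine le_trans ?_ (hle m) <;> simp only [A] <;> linarith [h1 m, h2 m, h3 m]

theorem continuous_toBCF_translate_smul {d : ℕ} (f : PerSmooth d) (s : ℝ) :
    Continuous fun y : EuclideanSpace ℝ (Fin d) => toBCF (translate (s • y.ofLp) f) :=
  (continuous_toBCF_translate f).comp (by fun_prop)

/-- Uniform boundedness of Littlewood-Paley blocks. -/
theorem exists_lpNorm_block_le {d : ℕ} (P : LittlewoodPaley d) : ∃ C : ℝ, 0 ≤ C ∧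
    ∀ (p : ℝ≥0∞) [Fact (1 ≤ p)] (m : ℕ) (f : PerSmooth d),
      lpNorm p (block P m f) ≤ C * lpNorm p f := by
  obtain ⟨C, hC0, hC⟩ := exists_integral_kernel_le P
  refine ⟨C, hC0, fun p _ m f => ?_⟩
  refine (lpNorm_le_integral p (P.integrable_kernel m)
    (continuous_toBCF_translate_smul f (scale m)) (fun y => norm_toBCF_translate_le _ f)
    (block_eq_integral P m f)).trans ?_
  simp only [lpNorm_translate, integral_mul_const]
  exact mul_le_mul_of_nonneg_right (hC m).1 (lpNorm_nonneg p f)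

/-- The sup-norm bound serves only to pass blocks through uniformly convergent series. -/
theorem exists_norm_block_le {d : ℕ} (P : LittlewoodPaley d) : ∃ C : ℝ, 0 ≤ C ∧
    ∀ (m : ℕ) (f : PerSmooth d) (M : ℝ), (∀ x, ‖(f : (Fin d → ℝ) → ℂ) x‖ ≤ M) →
      ∀ x, ‖(block P m f : (Fin d → ℝ) → ℂ) x‖ ≤ C * M := by
  obtain ⟨C, hC0, hC⟩ := exists_integral_kernel_le P
  refine ⟨C, hC0, fun m f M hM x => ?_⟩
  have hM0 : 0 ≤ M := (norm_nonneg _).trans (hM 0)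
  rw [block_eq_integral]
  refine (norm_integral_le_of_norm_le ((P.integrable_kernel m).norm.mul_const M)
    (Filter.Eventually.of_forall fun y => ?_)).trans ?_
  · rw [norm_mul]
    gcongr
    exact hM _
  · rw [integral_mul_const]
    exact mul_le_mul_of_nonneg_right (hC m).1 hM0

/-- A Bernstein-type estimate for the increments of a Littlewood-Paley block. -/
theorem exists_lpNorm_translate_block_sub_le {d : ℕ} (P : LittlewoodPaley d) : ∃ C : ℝ, 0 ≤ C ∧
    ∀ (p : ℝ≥0∞) [Fact (1 ≤ p)] (m : ℕ) (f : PerSmooth d) (t : EuclideanSpace ℝ (Fin d)),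
      lpNorm p (translate t.ofLp (block P m f) - block P m f) ≤ C * 2 ^ m * ‖t‖ * lpNorm p f := by
  obtain ⟨C, hC0, hC⟩ := exists_integral_kernel_le P
  refine ⟨C, hC0, fun p _ m f t => ?_⟩
  have hs := scale_pos m
  set ψ := P.kernel m
  -- Translating the block by t amounts to translating the kernel by t', in the rescaled kernel
  -- variable; the smoothness of f is not used.
  set t' := (scale m)⁻¹ • t
  have hw : Integrable fun y => ψ (y - t') - ψ y :=
    (ψ.integrable.comp_sub_right t').sub ψ.integrable
  obtain ⟨M, hM⟩ := exists_norm_le f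
  have hint : ∀ (x : Fin d → ℝ) (φ : EuclideanSpace ℝ (Fin d) → ℂ), Integrable φ →
      Integrable fun y => φ y * (f : (Fin d → ℝ) → ℂ) (x - scale m • y.ofLp) := by
    intro x φ hφ
    refine hφ.mul_bdd (c := M) ?_ (Filter.Eventually.of_forall fun y => hM _)
    exact (f.2.1.continuous.comp (by fun_prop)).aestronglyMeasurable
  refine (lpNorm_le_integral p hw (continuous_toBCF_translate_smul f (scale m))
    (fun y => norm_toBCF_translate_le _ f) fun x => ?_).trans ?_
  · change (block P m f : (Fin d → ℝ) → ℂ) (x - t.ofLp) - (block P m f : (Fin d → ℝ) → ℂ) x = _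
    rw [block_eq_integral, block_eq_integral]
    have h1 := integral_sub_right_eq_self (μ := volume)
      (fun y => ψ y * (f : (Fin d → ℝ) → ℂ) (x - t.ofLp - scale m • y.ofLp)) t'
    rw [← h1, ← integral_sub]
    · refine integral_congr_ae (Filter.Eventually.of_forall fun y => ?_)
      have h2 : x - t.ofLp - scale m • (y - t').ofLp = x - scale m • y.ofLp := by
        simp only [t', WithLp.ofLp_sub, WithLp.ofLp_smul, smul_sub, smul_smul,
          mul_inv_cancel₀ hs.ne', one_smul]
        abel
      simp only [h2, translate_apply]
      ring
    · exact (hint (x - t.ofLp) ψ ψ.integrable).comp_sub_right t'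
    · exact hint x ψ ψ.integrable
  · simp only [lpNorm_translate, integral_mul_const]
    refine mul_le_mul_of_nonneg_right ?_ (lpNorm_nonneg p f)
    refine (integral_norm_translate_sub_le ψ t').trans ?_
    have h3 : ‖t'‖ ≤ 2 ^ m * ‖t‖ := by
      simp only [t', norm_smul, norm_inv, Real.norm_of_nonneg hs.le]
      exact mul_le_mul_of_nonneg_right (scale_inv_le m) (norm_nonneg t)
    calc ‖t'‖ * ∫ y, ‖fderiv ℝ ψ y‖ ≤ (2 ^ m * ‖t‖) * C :=
          mul_le_mul h3 (hC m).2.2 (integral_nonneg fun _ => norm_nonneg _) (by positivity)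
      _ = _ := by ring

theorem lpNorm_mul_le {d : ℕ} {p q r : ℝ≥0∞} (h : r⁻¹ = p⁻¹ + q⁻¹) (f g : PerSmooth d) :
    lpNorm r (f * g) ≤ lpNorm p f * lpNorm q g := by
  have hpqr : ENNReal.HolderTriple p q r := ⟨h.symm⟩
  have hf := memLp_perSmooth p f
  have hg := memLp_perSmooth q g
  have key : eLpNorm ((f : (Fin d → ℝ) → ℂ) • (g : (Fin d → ℝ) → ℂ)) r (cubeMeasure d)
      ≤ eLpNorm (f : (Fin d → ℝ) → ℂ) p (cubeMeasure d)
        * eLpNorm (g : (Fin d → ℝ) → ℂ) q (cubeMeasure d) :=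
    eLpNorm_smul_le_mul_eLpNorm hg.1 hf.1
  have h2 := ENNReal.toReal_mono (ENNReal.mul_ne_top hf.2.ne hg.2.ne) key
  rw [ENNReal.toReal_mul] at h2
  exact h2

theorem lpNorm_mul_mul_le {d : ℕ} {p p₁ p₂ p₃ : ℝ≥0∞} (hp : p⁻¹ = p₁⁻¹ + p₂⁻¹ + p₃⁻¹)
    (f g h : PerSmooth d) : lpNorm p (f * g * h) ≤ lpNorm p₁ f * lpNorm p₂ g * lpNorm p₃ h := by
  have h1 := lpNorm_mul_le (p := (p₁⁻¹ + p₂⁻¹)⁻¹) (q := p₃) (r := p) (by rw [inv_inv, hp]) (f * g) h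
  refine h1.trans (mul_le_mul_of_nonneg_right ?_ (lpNorm_nonneg p₃ h))
  exact lpNorm_mul_le (by rw [inv_inv]) f g

/-- The commutator of a Littlewood-Paley block with the multiplication by a function `u` gains one
power of the length scale if `u` is Lipschitz in the `L^p` sense. -/
theorem exists_lpNorm_commutator_mul_le {d : ℕ} (P : LittlewoodPaley d) : ∃ C : ℝ, 0 ≤ C ∧
    ∀ (p p₁ p₂ p₃ : ℝ≥0∞) [Fact (1 ≤ p)], p⁻¹ = p₁⁻¹ + p₂⁻¹ + p₃⁻¹ →
      ∀ (m : ℕ) (u v w : PerSmooth d) (K : ℝ), 0 ≤ K →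
        (∀ t : EuclideanSpace ℝ (Fin d), lpNorm p₁ (translate t.ofLp u - u) ≤ K * ‖t‖) →
        lpNorm p ((block P m (u * v) - u * block P m v) * w)
          ≤ C * (2 ^ m)⁻¹ * K * lpNorm p₂ v * lpNorm p₃ w := by
  obtain ⟨C, hC0, hC⟩ := exists_integral_kernel_le P
  refine ⟨2 * C, by positivity, fun p p₁ p₂ p₃ _ hp m u v w K hK0 hK => ?_⟩
  have hs := scale_pos m
  -- The integral formula gives δ(uv) - u δv as the average of (u(x - sy) - u(x)) v(x - sy) against
  -- the kernel, with s the scale; G y is this integrand times w.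
  let G : EuclideanSpace ℝ (Fin d) → PerSmooth d := fun y =>
    (translate (scale m • y.ofLp) u - u) * translate (scale m • y.ofLp) v * w
  have hGe : ∀ y, toBCF (G y) = (toBCF (translate (scale m • y.ofLp) u) - toBCF u) *
      toBCF (translate (scale m • y.ofLp) v) * toBCF w := fun y => by
    ext x
    rfl
  have hG : Continuous fun y => toBCF (G y) := by
    simp only [hGe]
    exact (((continuous_toBCF_translate_smul u _).sub continuous_const).mul
      (continuous_toBCF_translate_smul v _)).mul continuous_const
  have hGM : ∀ y, ‖toBCF (G y)‖ ≤ (‖toBCF u‖ + ‖toBCF u‖) * ‖toBCF v‖ * ‖toBCF w‖ := fun y => by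
    rw [hGe]
    refine (norm_mul_le _ _).trans ?_
    gcongr
    refine (norm_mul_le _ _).trans ?_
    gcongr
    · refine (norm_sub_le _ _).trans ?_
      gcongr
      exact norm_toBCF_translate_le _ u
    · exact norm_toBCF_translate_le _ v
  have hint : ∀ (x : Fin d → ℝ) (f : PerSmooth d),
      Integrable fun y => P.kernel m y * (f : (Fin d → ℝ) → ℂ) (x - scale m • y.ofLp) := by
    intro x f
    obtain ⟨M, hM⟩ := exists_norm_le f
    refine (P.integrable_kernel m).mul_bdd (c := M) ?_ (Filter.Eventually.of_forall fun y => hM _)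
    exact (f.2.1.continuous.comp (by fun_prop)).aestronglyMeasurable
  refine (lpNorm_le_integral p (P.integrable_kernel m) hG hGM fun x => ?_).trans ?_
  · change ((block P m (u * v) : (Fin d → ℝ) → ℂ) x
      - (u : (Fin d → ℝ) → ℂ) x * (block P m v : (Fin d → ℝ) → ℂ) x) * (w : (Fin d → ℝ) → ℂ) x = _
    rw [block_eq_integral, block_eq_integral, ← integral_const_mul, ← integral_sub (hint x (u * v))
      ((hint x v).const_mul _), ← integral_mul_const]
    refine integral_congr_ae (Filter.Eventually.of_forall fun y => ?_)
    change (P.kernel m y * ((u : (Fin d → ℝ) → ℂ) (x - scale m • y.ofLp) *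
      (v : (Fin d → ℝ) → ℂ) (x - scale m • y.ofLp)) - (u : (Fin d → ℝ) → ℂ) x *
      (P.kernel m y * (v : (Fin d → ℝ) → ℂ) (x - scale m • y.ofLp))) * (w : (Fin d → ℝ) → ℂ) x =
      P.kernel m y * (((u : (Fin d → ℝ) → ℂ) (x - scale m • y.ofLp) - (u : (Fin d → ℝ) → ℂ) x) *
      (v : (Fin d → ℝ) → ℂ) (x - scale m • y.ofLp) * (w : (Fin d → ℝ) → ℂ) x)
    ring
  · set B := K * scale m * lpNorm p₂ v * lpNorm p₃ w
    -- Hölder and the increment bound on u yield one factor `scale m`, the gain, and one factor ‖y‖,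
    -- absorbed by the first moment of the kernel.
    have hGp : ∀ y, lpNorm p (G y) ≤ ‖y‖ * B := fun y => by
      refine (lpNorm_mul_mul_le hp _ _ w).trans ?_
      have h1 := hK (scale m • y)
      rw [norm_smul, Real.norm_of_nonneg hs.le] at h1
      rw [lpNorm_translate]
      calc _ ≤ (K * (scale m * ‖y‖)) * lpNorm p₂ v * lpNorm p₃ w := by
            gcongr
            · exact lpNorm_nonneg _ _
            · exact lpNorm_nonneg _ _
            · exact h1
        _ = _ := by simp only [B]; ring
    have hky : Integrable fun y => ‖P.kernel m y‖ * ‖y‖ := by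
      simpa [mul_comm] using (P.kernel m).integrable_pow_mul volume 1
    have hv := lpNorm_nonneg p₂ v
    have hw := lpNorm_nonneg p₃ w
    calc ∫ y, ‖P.kernel m y‖ * lpNorm p (G y) ≤ ∫ y, ‖P.kernel m y‖ * ‖y‖ * B := by
          refine integral_mono_of_nonneg (Filter.Eventually.of_forall fun y =>
            mul_nonneg (norm_nonneg _) (lpNorm_nonneg _ _)) (hky.mul_const B)
            (Filter.Eventually.of_forall fun y => ?_)
          simp only [mul_assoc]
          exact mul_le_mul_of_nonneg_left (hGp y) (norm_nonneg _)
      _ = (∫ y, ‖P.kernel m y‖ * ‖y‖) * B := integral_mul_const _ _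
      _ ≤ C * (K * (2 * (2 ^ m)⁻¹) * lpNorm p₂ v * lpNorm p₃ w) := by
          have := (hC m).2.1
          have := scale_le m
          simp only [B]
          gcongr
      _ = _ := by ring

/-! ### Fourier coefficients of series, blocks and products -/

theorem volume_real_unitCube (d : ℕ) : volume.real (Set.Icc (0 : Fin d → ℝ) 1) = 1 := by
  simp [measureReal_def, Real.volume_Icc_pi]

theorem integrableOn_character_mul {d : ℕ} (n : Fin d → ℤ) (f : PerSmooth d) :
    IntegrableOn (fun x => character n x * (f : (Fin d → ℝ) → ℂ) x)
      (Set.Icc (0 : Fin d → ℝ) 1) :=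
  ((character_mem n).1.continuous.mul f.2.1.continuous).integrableOn_Icc

theorem hasSum_fourierCoeff {d : ℕ} {ι : Type*} [Countable ι] {T : ι → PerSmooth d} {b : ι → ℝ}
    (hb : Summable b) (hT : ∀ q x, ‖(T q : (Fin d → ℝ) → ℂ) x‖ ≤ b q) {F : PerSmooth d}
    (hF : ∀ x, HasSum (fun q => (T q : (Fin d → ℝ) → ℂ) x) ((F : (Fin d → ℝ) → ℂ) x))
    (n : Fin d → ℤ) :
    HasSum (fun q => fourierCoeff (T q : (Fin d → ℝ) → ℂ) n)
      (fourierCoeff (F : (Fin d → ℝ) → ℂ) n) := by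
  have h := hasSum_integral_of_summable_integral_norm
    (F := fun q x => character (-n) x * (T q : (Fin d → ℝ) → ℂ) x)
    (μ := volume.restrict (Set.Icc (0 : Fin d → ℝ) 1))
    (fun q => integrableOn_character_mul (-n) (T q)) (by
      refine Summable.of_nonneg_of_le (fun q => integral_nonneg fun _ => norm_nonneg _)
        (fun q => ?_) hb
      have := integral_mono_of_nonneg (μ := volume.restrict (Set.Icc (0 : Fin d → ℝ) 1))
        (f := fun x => ‖character (-n) x * (T q : (Fin d → ℝ) → ℂ) x‖) (g := fun _ => b q)
        (Filter.Eventually.of_forall fun _ => norm_nonneg _)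
        (integrableOn_const (by simp [Real.volume_Icc_pi]))
        (Filter.Eventually.of_forall fun x => by
          simp only [norm_mul, norm_character, one_mul]
          exact hT q x)
      refine this.trans_eq ?_
      rw [setIntegral_const, volume_real_unitCube, one_smul])
  have e : ∀ x, ∑' q, character (-n) x * (T q : (Fin d → ℝ) → ℂ) x
      = character (-n) x * (F : (Fin d → ℝ) → ℂ) x := fun x => ((hF x).mul_left _).tsum_eq
  simp only [e] at h
  exact h

theorem character_mul {d : ℕ} (n k : Fin d → ℤ) (x : Fin d → ℝ) :
    character n x * character k x = character (n + k) x := by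
  unfold character
  rw [← Complex.exp_add]
  congr 1
  simp only [Pi.add_apply, Int.cast_add, add_mul, Finset.sum_add_distrib]
  push_cast
  ring

theorem integral_character {d : ℕ} {n : Fin d → ℤ} (hn : n ≠ 0) :
    ∫ x in Set.Icc (0 : Fin d → ℝ) 1, character n x = 0 := by
  obtain ⟨i, hi⟩ := Function.ne_iff.1 hn
  have h := integral_partialDeriv i (character_mem n)
  simp only [partialDeriv_character] at h
  rw [integral_const_mul] at h
  refine (mul_eq_zero.1 h).resolve_left ?_
  have : (n i : ℂ) ≠ 0 := Int.cast_ne_zero.2 hi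
  simp [Real.pi_ne_zero, this]

/-- The character as a smooth periodic function. -/
noncomputable def characterPer {d : ℕ} (n : Fin d → ℤ) : PerSmooth d :=
  ⟨character n, character_mem n⟩

theorem fourierCoeff_character_mul {d : ℕ} (k n : Fin d → ℤ) (f : PerSmooth d) :
    fourierCoeff ((characterPer k * f : PerSmooth d) : (Fin d → ℝ) → ℂ) n
      = fourierCoeff (f : (Fin d → ℝ) → ℂ) (n - k) := by
  unfold fourierCoeff
  refine integral_congr_ae (Filter.Eventually.of_forall fun x => ?_)
  change character (-n) x * (character k x * (f : (Fin d → ℝ) → ℂ) x) = _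
  rw [← mul_assoc, character_mul, neg_sub, neg_add_eq_sub]

theorem fourierCoeff_character {d : ℕ} (k n : Fin d → ℤ) :
    fourierCoeff (character k) n = if n = k then 1 else 0 := by
  unfold fourierCoeff
  simp only [character_mul]
  split_ifs with h
  · subst h
    have : ∀ x : Fin d → ℝ, character (-n + n) x = 1 := fun x => by simp [character]
    simp only [this]
    rw [setIntegral_const, volume_real_unitCube, one_smul]
  · exact integral_character fun h0 => h (by rw [← sub_eq_zero, ← neg_eq_zero, ← h0]; abel)

theorem fourierCoeff_smul {d : ℕ} (c : ℂ) (f : PerSmooth d) (n : Fin d → ℤ) :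
    fourierCoeff ((c • f : PerSmooth d) : (Fin d → ℝ) → ℂ) n
      = c * fourierCoeff (f : (Fin d → ℝ) → ℂ) n := by
  unfold fourierCoeff
  rw [← integral_const_mul]
  refine integral_congr_ae (Filter.Eventually.of_forall fun x => ?_)
  change character (-n) x * (c * (f : (Fin d → ℝ) → ℂ) x) = _
  ring

theorem fourierCoeff_sum {d : ℕ} {ι : Type*} (s : Finset ι) (T : ι → PerSmooth d)
    (n : Fin d → ℤ) : fourierCoeff ((∑ q ∈ s, T q : PerSmooth d) : (Fin d → ℝ) → ℂ) n
      = ∑ q ∈ s, fourierCoeff (T q : (Fin d → ℝ) → ℂ) n := by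
  unfold fourierCoeff
  rw [← integral_finsetSum _ fun q _ => integrableOn_character_mul (-n) (T q)]
  refine integral_congr_ae (Filter.Eventually.of_forall fun x => ?_)
  simp [Finset.mul_sum]

/-- The coefficients of an absolutely convergent trigonometric series are its Fourier
coefficients. -/
theorem fourierCoeff_eq_of_hasSum {d : ℕ} {a : (Fin d → ℤ) → ℂ} (ha : Summable fun k => ‖a k‖)
    {F : PerSmooth d} (hF : ∀ x, HasSum (fun k => a k * character k x) ((F : (Fin d → ℝ) → ℂ) x))
    (n : Fin d → ℤ) : fourierCoeff (F : (Fin d → ℝ) → ℂ) n = a n := by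
  have h := hasSum_fourierCoeff (T := fun k => a k • characterPer k) ha (fun k x => by
    change ‖a k * character k x‖ ≤ _
    rw [norm_mul, norm_character, mul_one]) hF n
  have e : ∀ k, fourierCoeff ((a k • characterPer k : PerSmooth d) : (Fin d → ℝ) → ℂ) n
      = if k = n then a n else 0 := fun k => by
    rw [fourierCoeff_smul]
    change a k * fourierCoeff (character k) n = _
    rw [fourierCoeff_character]
    by_cases hk : n = k
    · simp [hk]
    · simp [hk, Ne.symm hk]
  simp only [e] at h
  exact h.unique (hasSum_ite_eq n (a n))

theorem fourierCoeff_block {d : ℕ} (P : LittlewoodPaley d) (m : ℕ) (f : PerSmooth d)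
    (n : Fin d → ℤ) : fourierCoeff (block P m f : (Fin d → ℝ) → ℂ) n
      = P.cutoff m (frequency n) * fourierCoeff (f : (Fin d → ℝ) → ℂ) n := by
  refine fourierCoeff_eq_of_hasSum
    (a := fun n => P.cutoff m (frequency n) * fourierCoeff (f : (Fin d → ℝ) → ℂ) n) ?_
    (fun x => (summable_block_term P m f.2 x).hasSum) n
  refine Summable.of_nonneg_of_le (fun _ => norm_nonneg _) (fun k => ?_)
    (norm_fourierCoeff_summable f)
  rw [norm_mul, Complex.norm_real, Real.norm_of_nonneg (P.cutoff_mem m _).1]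
  exact mul_le_of_le_one_left (norm_nonneg _) (P.cutoff_mem m _).2

/-- Only f is expanded in its Fourier series: multiplying g by a character merely shifts the
coefficients of g. -/
theorem hasSum_fourierCoeff_mul {d : ℕ} (f g : PerSmooth d) (n : Fin d → ℤ) :
    HasSum (fun k => fourierCoeff (f : (Fin d → ℝ) → ℂ) k *
      fourierCoeff (g : (Fin d → ℝ) → ℂ) (n - k))
      (fourierCoeff ((f * g : PerSmooth d) : (Fin d → ℝ) → ℂ) n) := by
  obtain ⟨M, hM⟩ := exists_norm_le g
  have h := hasSum_fourierCoeff
    (T := fun k => fourierCoeff (f : (Fin d → ℝ) → ℂ) k • (characterPer k * g))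
    (b := fun k => ‖fourierCoeff (f : (Fin d → ℝ) → ℂ) k‖ * M)
    ((norm_fourierCoeff_summable f).mul_right M) (fun k x => by
      change ‖fourierCoeff (f : (Fin d → ℝ) → ℂ) k * (character k x * (g : (Fin d → ℝ) → ℂ) x)‖ ≤ _
      rw [norm_mul, norm_mul, norm_character, one_mul]
      gcongr
      exact hM x) (F := f * g) (fun x => by
      have := (hasSum_fourier f.2 x).mul_right ((g : (Fin d → ℝ) → ℂ) x)
      simp only [mul_assoc] at this
      exact this) n
  simpa only [fourierCoeff_smul, fourierCoeff_character_mul] using h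

/-! ### Spectral supports and vanishing blocks -/

/-- The Fourier coefficients of `f` vanish at frequencies of norm at least `R`. -/
def SpectrumLT {d : ℕ} (f : PerSmooth d) (R : ℝ) : Prop :=
  ∀ n, R ≤ ‖frequency n‖ → fourierCoeff (f : (Fin d → ℝ) → ℂ) n = 0

/-- The Fourier coefficients of `f` vanish at frequencies of norm less than `R`. -/
def SpectrumGE {d : ℕ} (f : PerSmooth d) (R : ℝ) : Prop :=
  ∀ n, ‖frequency n‖ < R → fourierCoeff (f : (Fin d → ℝ) → ℂ) n = 0

theorem frequency_add {d : ℕ} (n k : Fin d → ℤ) :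
    frequency (n + k) = frequency n + frequency k := by
  ext i
  simp [frequency, mul_add]

theorem SpectrumLT.mono {d : ℕ} {f : PerSmooth d} {R R' : ℝ} (h : SpectrumLT f R) (hR : R ≤ R') :
    SpectrumLT f R' :=
  fun n hn => h n (hR.trans hn)

theorem SpectrumLT.sum {d : ℕ} {ι : Type*} {s : Finset ι} {T : ι → PerSmooth d} {R : ℝ}
    (h : ∀ q ∈ s, SpectrumLT (T q) R) : SpectrumLT (∑ q ∈ s, T q) R := fun n hn => by
  rw [fourierCoeff_sum]
  exact Finset.sum_eq_zero fun q hq => h q hq n hn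

/-- In the convolution, frequencies of k and n - k add up to that of n; by the triangle inequality
they cannot both be small when that of n is large. -/
theorem SpectrumLT.mul {d : ℕ} {f g : PerSmooth d} {R R' : ℝ} (hf : SpectrumLT f R)
    (hg : SpectrumLT g R') : SpectrumLT (f * g) (R + R') := fun n hn => by
  rw [← (hasSum_fourierCoeff_mul f g n).tsum_eq]
  refine (tsum_congr fun k => ?_).trans tsum_zero
  by_cases hk : R ≤ ‖frequency k‖
  · rw [hf k hk, zero_mul]
  · rw [hg (n - k), mul_zero]
    have h1 := norm_add_le (frequency k) (frequency (n - k))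
    rw [← frequency_add, add_sub_cancel] at h1
    linarith

theorem SpectrumLT.mul_spectrumGE {d : ℕ} {f g : PerSmooth d} {R R' : ℝ} (hf : SpectrumLT f R)
    (hg : SpectrumGE g R') : SpectrumGE (f * g) (R' - R) := fun n hn => by
  rw [← (hasSum_fourierCoeff_mul f g n).tsum_eq]
  refine (tsum_congr fun k => ?_).trans tsum_zero
  by_cases hk : R ≤ ‖frequency k‖
  · rw [hf k hk, zero_mul]
  · rw [hg (n - k), mul_zero]
    have h1 := norm_sub_le (frequency n) (frequency k)
    have h2 : frequency n - frequency k = frequency (n - k) := by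
      rw [sub_eq_iff_eq_add', ← frequency_add, add_sub_cancel]
    rw [h2] at h1
    linarith

/-- Because of the index shift, a cutoff with m ≥ 1 lives in the annulus of radii (3/4) 2^(m-1) and
(8/3) 2^(m-1), whence 3/8 and 4/3. The outer radius is also right for the ball at m = 0; the inner
one is not. -/
theorem LittlewoodPaley.norm_lt_of_cutoff_ne_zero {d : ℕ} (P : LittlewoodPaley d) {m : ℕ}
    {ζ : EuclideanSpace ℝ (Fin d)} (h : P.cutoff m ζ ≠ 0) : ‖ζ‖ < 4 / 3 * 2 ^ m := by
  cases m with
  | zero =>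
    have h1 := P.tsupport_low (subset_tsupport _ h)
    rw [mem_ball_zero_iff] at h1
    simpa using h1
  | succ k =>
    have h1 := (P.tsupport_ann (subset_tsupport _ h)).1
    rw [mem_ball_zero_iff, norm_smul, norm_inv, Real.norm_of_nonneg (by positivity),
      ← div_eq_inv_mul, div_lt_iff₀ (by positivity)] at h1
    rw [pow_succ]
    linarith

theorem LittlewoodPaley.le_norm_of_cutoff_ne_zero {d : ℕ} (P : LittlewoodPaley d) {m : ℕ}
    (hm : 1 ≤ m) {ζ : EuclideanSpace ℝ (Fin d)} (h : P.cutoff m ζ ≠ 0) : 3 / 8 * 2 ^ m ≤ ‖ζ‖ := by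
  cases m with
  | zero => omega
  | succ k =>
    have h1 := (P.tsupport_ann (subset_tsupport _ h)).2
    rw [mem_ball_zero_iff, not_lt, norm_smul, norm_inv, Real.norm_of_nonneg (by positivity),
      ← div_eq_inv_mul, le_div_iff₀ (by positivity)] at h1
    rw [pow_succ]
    linarith

theorem spectrumLT_block {d : ℕ} (P : LittlewoodPaley d) (m : ℕ) (f : PerSmooth d) :
    SpectrumLT (block P m f) (4 / 3 * 2 ^ m) := fun n hn => by
  rw [fourierCoeff_block]
  by_cases h : P.cutoff m (frequency n) = 0
  · simp [h]
  · exact absurd (P.norm_lt_of_cutoff_ne_zero h) hn.not_gt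

theorem spectrumGE_block {d : ℕ} (P : LittlewoodPaley d) {m : ℕ} (hm : 1 ≤ m) (f : PerSmooth d) :
    SpectrumGE (block P m f) (3 / 8 * 2 ^ m) := fun n hn => by
  rw [fourierCoeff_block]
  by_cases h : P.cutoff m (frequency n) = 0
  · simp [h]
  · exact absurd (P.le_norm_of_cutoff_ne_zero hm h) hn.not_ge

theorem block_eq_zero {d : ℕ} (P : LittlewoodPaley d) (m : ℕ) (f : PerSmooth d)
    (h : ∀ n, P.cutoff m (frequency n) ≠ 0 → fourierCoeff (f : (Fin d → ℝ) → ℂ) n = 0) :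
    block P m f = 0 := by
  ext x
  change blockFun P m f x = 0
  unfold blockFun
  refine (tsum_congr fun n => ?_).trans tsum_zero
  by_cases hn : P.cutoff m (frequency n) = 0
  · simp [hn]
  · simp [h n hn]

theorem SpectrumLT.block_eq_zero {d : ℕ} (P : LittlewoodPaley d) {m : ℕ} (hm : 1 ≤ m)
    {f : PerSmooth d} {R : ℝ} (h : SpectrumLT f R) (hR : R ≤ 3 / 8 * 2 ^ m) : block P m f = 0 :=
  BesovTorus.block_eq_zero P m f fun n hn => h n (hR.trans (P.le_norm_of_cutoff_ne_zero hm hn))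

theorem SpectrumGE.block_eq_zero {d : ℕ} (P : LittlewoodPaley d) {m : ℕ}
    {f : PerSmooth d} {R : ℝ} (h : SpectrumGE f R) (hR : 4 / 3 * 2 ^ m ≤ R) : block P m f = 0 :=
  BesovTorus.block_eq_zero P m f fun n hn =>
    h n ((P.norm_lt_of_cutoff_ne_zero hn).trans_le hR)

theorem block_block_eq_zero {d : ℕ} (P : LittlewoodPaley d) {i l : ℕ}
    (h : i + 2 ≤ l ∨ l + 2 ≤ i) (f : PerSmooth d) : block P i (block P l f) = 0 := by
  rcases h with h | h
  · refine (spectrumGE_block P (by omega) f).block_eq_zero P ?_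
    have : (2 : ℝ) ^ (i + 2) ≤ 2 ^ l := pow_le_pow_right₀ one_le_two h
    rw [pow_add] at this
    linarith [pow_pos (two_pos : (0 : ℝ) < 2) i]
  · refine (spectrumLT_block P l f).block_eq_zero P (by omega) ?_
    have : (2 : ℝ) ^ (l + 2) ≤ 2 ^ i := pow_le_pow_right₀ one_le_two h
    rw [pow_add] at this
    linarith [pow_pos (two_pos : (0 : ℝ) < 2) l]

/-! ### Uniformly convergent series and the Littlewood-Paley decomposition -/

/-- Blocks commute with uniformly absolutely convergent series. -/
theorem hasSum_block {d : ℕ} (P : LittlewoodPaley d) (m : ℕ) {ι : Type*} {T : ι → PerSmooth d}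
    {b : ι → ℝ} (hb : Summable b) (hT : ∀ q x, ‖(T q : (Fin d → ℝ) → ℂ) x‖ ≤ b q) {F : PerSmooth d}
    (hF : ∀ x, HasSum (fun q => (T q : (Fin d → ℝ) → ℂ) x) ((F : (Fin d → ℝ) → ℂ) x))
    (x : Fin d → ℝ) :
    HasSum (fun q => (block P m (T q) : (Fin d → ℝ) → ℂ) x)
      ((block P m F : (Fin d → ℝ) → ℂ) x) := by
  obtain ⟨C, hC0, hC⟩ := exists_norm_block_le P
  have htail : Filter.Tendsto (fun s : Finset ι => C * (∑' q, b q - ∑ q ∈ s, b q)) Filter.atTop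
      (nhds 0) := by
    have := (tendsto_const_nhds (x := ∑' q, b q)).sub hb.hasSum
    simpa using this.const_mul C
  refine tendsto_iff_norm_sub_tendsto_zero.2 (squeeze_zero (fun _ => norm_nonneg _) (fun s => ?_)
    htail)
  have h := hC m (∑ q ∈ s, T q - F) (∑' q, b q - ∑ q ∈ s, b q) (fun y => ?_) x
  · rw [map_sub, map_sum] at h
    refine (le_of_eq ?_).trans h
    congr 1
    simp
  · have h1 : ((∑ q ∈ s, T q - F : PerSmooth d) : (Fin d → ℝ) → ℂ) y
        = ∑ q ∈ s, (T q : (Fin d → ℝ) → ℂ) y - (F : (Fin d → ℝ) → ℂ) y := by simp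
    rw [h1, norm_sub_rev, ← (hF y).tsum_eq, ← (hF y).summable.sum_add_tsum_subtype_compl s,
      add_sub_cancel_left, ← hb.sum_add_tsum_subtype_compl s, add_sub_cancel_left]
    exact tsum_of_norm_bounded (hb.subtype _).hasSum fun q => hT q y

/-- An `L^p` bound for all finite partial sums of a uniformly absolutely convergent series passes
to the sum. -/
theorem lpNorm_le_of_hasSum {d : ℕ} (p : ℝ≥0∞) [Fact (1 ≤ p)] {ι : Type*} {T : ι → PerSmooth d}
    {b : ι → ℝ} (hb : Summable b) (hT : ∀ q x, ‖(T q : (Fin d → ℝ) → ℂ) x‖ ≤ b q) {F : PerSmooth d}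
    (hF : ∀ x, HasSum (fun q => (T q : (Fin d → ℝ) → ℂ) x) ((F : (Fin d → ℝ) → ℂ) x))
    {B : ℝ} (hB : ∀ s : Finset ι, lpNorm p (∑ q ∈ s, T q) ≤ B) : lpNorm p F ≤ B := by
  obtain ⟨V, hV0, hV⟩ := exists_lpNorm_le_sup d p
  have htail : Filter.Tendsto (fun s : Finset ι => V * (∑' q, b q - ∑ q ∈ s, b q) + B) Filter.atTop
      (nhds B) := by
    have := (tendsto_const_nhds (x := ∑' q, b q)).sub hb.hasSum
    simpa using (this.const_mul V).add_const B
  refine ge_of_tendsto' htail fun s => ?_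
  have hs : (F - ∑ q ∈ s, T q) + ∑ q ∈ s, T q = F := sub_add_cancel _ _
  rw [← hs]
  have hb0 : ∀ q, 0 ≤ b q := fun q => (norm_nonneg _).trans (hT q 0)
  refine (lpNorm_add_le p _ _).trans (add_le_add (hV _ _ ?_ fun y => ?_) (hB s))
  · exact sub_nonneg.2 (hb.sum_le_tsum s fun q _ => hb0 q)
  · have h1 : ((F - ∑ q ∈ s, T q : PerSmooth d) : (Fin d → ℝ) → ℂ) y
        = (F : (Fin d → ℝ) → ℂ) y - ∑ q ∈ s, (T q : (Fin d → ℝ) → ℂ) y := by simp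
    rw [h1, ← (hF y).tsum_eq, ← (hF y).summable.sum_add_tsum_subtype_compl s,
      add_sub_cancel_left, ← hb.sum_add_tsum_subtype_compl s, add_sub_cancel_left]
    exact tsum_of_norm_bounded (hb.subtype _).hasSum fun q => hT q y

theorem summable_two_pow_inv_mul (C : ℝ) : Summable fun m : ℕ => ((2 : ℝ) ^ m)⁻¹ * C := by
  refine Summable.mul_right C ?_
  simpa [inv_pow] using summable_geometric_of_lt_one (r := (2 : ℝ)⁻¹) (by norm_num) (by norm_num)

theorem exists_norm_block_le_two_pow_inv {d : ℕ} (P : LittlewoodPaley d) (f : PerSmooth d) :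
    ∃ C : ℝ, 0 ≤ C ∧ ∀ m x, ‖(block P m f : (Fin d → ℝ) → ℂ) x‖ ≤ ((2 : ℝ) ^ m)⁻¹ * C := by
  obtain ⟨C, hC0, hC⟩ := exists_block_le P f.2 1 0
  refine ⟨C, hC0, fun m x => ?_⟩
  have h := hC m x
  rwa [norm_iteratedFDeriv_zero, pow_one] at h

/-- The Littlewood-Paley decomposition `f = ∑_m δ_{m-1} f`. -/
theorem hasSum_block_apply {d : ℕ} (P : LittlewoodPaley d) (f : PerSmooth d) (x : Fin d → ℝ) :
    HasSum (fun m => (block P m f : (Fin d → ℝ) → ℂ) x) ((f : (Fin d → ℝ) → ℂ) x) := by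
  set a : (Fin d → ℤ) → ℂ := fun n => fourierCoeff (f : (Fin d → ℝ) → ℂ) n * character n x
  have ha : Summable fun n => ‖a n‖ := by
    simpa only [a, norm_mul, norm_character, mul_one] using norm_fourierCoeff_summable f
  have hc : ∀ n, HasSum (fun m => (P.cutoff m (frequency n) : ℂ) * a n) (a n) := fun n => by
    have := (Complex.hasSum_ofReal.2 (P.hasSum_cutoff (frequency n))).mul_right (a n)
    simpa using this
  have hnorm : ∀ (m : ℕ) n, ‖(P.cutoff m (frequency n) : ℂ) * a n‖
      = P.cutoff m (frequency n) * ‖a n‖ := fun m n => by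
    rw [norm_mul, Complex.norm_real, Real.norm_of_nonneg (P.cutoff_mem m _).1]
  -- The cutoffs are nonnegative and sum to 1, so the double series in (n, m) converges absolutely.
  -- Summing over m first gives f, over n first gives the blocks.
  have hsum : Summable fun q : (Fin d → ℤ) × ℕ => (P.cutoff q.2 (frequency q.1) : ℂ) * a q.1 := by
    refine Summable.of_norm ((summable_prod_of_nonneg fun q => norm_nonneg _).2 ⟨fun n => ?_, ?_⟩)
    · exact (hc n).summable.norm
    · refine ha.congr fun n => ?_
      have := ((P.hasSum_cutoff (frequency n)).mul_right ‖a n‖).tsum_eq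
      rw [one_mul] at this
      rw [← this]
      exact tsum_congr fun m => (hnorm m n).symm
  have h1 := (hsum.hasSum.prod_fiberwise hc).unique (hasSum_fourier f.2 x)
  have h2 := hsum.prod_symm.hasSum.prod_fiberwise
    (g := fun m => (block P m f : (Fin d → ℝ) → ℂ) x) fun m => by
      have := (summable_block_term P m f.2 x).hasSum
      have e : (block P m f : (Fin d → ℝ) → ℂ) x = ∑' n, ((P.cutoff m (frequency n) : ℂ) *
          fourierCoeff (f : (Fin d → ℝ) → ℂ) n) • character n x := rfl
      rw [← e] at this
      refine this.congr_fun fun n => ?_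
      rw [smul_eq_mul, mul_assoc]
      rfl
  have h3 : ∑' q : ℕ × (Fin d → ℤ), (P.cutoff q.swap.2 (frequency q.swap.1) : ℂ) * a q.swap.1
      = (f : (Fin d → ℝ) → ℂ) x := by
    rw [← h1]
    exact (Equiv.prodComm ℕ (Fin d → ℤ)).tsum_eq
      fun q : (Fin d → ℤ) × ℕ => (P.cutoff q.2 (frequency q.1) : ℂ) * a q.1
  rw [← h3]
  exact h2

/-! ### Frequency windows and low-frequency partial sums -/

/-- The indices at distance at most `5` from `i`. -/
def window (i : ℕ) : Finset ℕ := Finset.Icc (i - 5) (i + 5)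

theorem mem_window {i l : ℕ} : l ∈ window i ↔ i ≤ l + 5 ∧ l ≤ i + 5 := by
  rw [window, Finset.mem_Icc]
  omega

theorem card_window_le (i : ℕ) : (window i).card ≤ 11 := by
  rw [window, Nat.card_Icc]
  omega

/-- x + x⁻¹ dominates x, x⁻¹ and 1, so one constant covers shifts in both directions and both x < 1
and x > 1. -/
theorem pow_le_of_mem_window {x : ℝ} (hx : 0 < x) {i l : ℕ} (h : l ∈ window i) :
    x ^ l ≤ (x + x⁻¹) ^ 5 * x ^ i := by
  rw [mem_window] at h
  have hx' : 0 < x⁻¹ := inv_pos.2 hx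
  have h1 : 1 ≤ x + x⁻¹ := by
    rcases le_total 1 x with h1 | h1
    · linarith
    · linarith [(one_le_inv₀ hx).2 h1]
  rcases le_total i l with hil | hil
  · obtain ⟨e, rfl⟩ := Nat.exists_eq_add_of_le hil
    rw [pow_add, mul_comm]
    gcongr
    calc x ^ e ≤ (x + x⁻¹) ^ e := pow_le_pow_left₀ hx.le (by linarith) e
      _ ≤ (x + x⁻¹) ^ 5 := pow_le_pow_right₀ h1 (by omega)
  · obtain ⟨e, rfl⟩ := Nat.exists_eq_add_of_le hil
    have h2 : x⁻¹ ^ e ≤ (x + x⁻¹) ^ 5 :=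
      (pow_le_pow_left₀ hx'.le (by linarith) e).trans (pow_le_pow_right₀ h1 (by omega))
    calc x ^ l = x⁻¹ ^ e * x ^ (l + e) := by
          rw [pow_add, inv_pow]
          field_simp
      _ ≤ _ := by gcongr

theorem block_eq_sum_window_left {d : ℕ} (P : LittlewoodPaley d) (i : ℕ) (g : PerSmooth d) :
    block P i g = ∑ l ∈ window i, block P i (block P l g) := by
  obtain ⟨C, -, hC⟩ := exists_norm_block_le_two_pow_inv P g
  ext x
  have h := hasSum_block P i (summable_two_pow_inv_mul C) hC (hasSum_block_apply P g) x
  refine (h.unique (hasSum_sum_of_ne_finset_zero (s := window i) fun l hl => ?_)).trans (by simp)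
  rw [mem_window] at hl
  rw [block_block_eq_zero P (by omega)]
  rfl

theorem block_eq_sum_window_right {d : ℕ} (P : LittlewoodPaley d) (i : ℕ) (g : PerSmooth d) :
    block P i g = ∑ l ∈ window i, block P l (block P i g) := by
  ext x
  have h := hasSum_block_apply P (block P i g) x
  refine (h.unique (hasSum_sum_of_ne_finset_zero (s := window i) fun l hl => ?_)).trans (by simp)
  rw [mem_window] at hl
  rw [block_block_eq_zero P (by omega)]
  rfl

theorem translate_sum {d : ℕ} {ι : Type*} (s : Finset ι) (T : ι → PerSmooth d)
    (t : Fin d → ℝ) : translate t (∑ q ∈ s, T q) = ∑ q ∈ s, translate t (T q) := by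
  ext x
  simp

/-- Improves the increment bound by having the block itself on the right: δ_m f is the sum of at
most eleven neighbouring blocks of itself, and the previous bound applies to each of them. -/
theorem exists_lpNorm_translate_block_sub_le' {d : ℕ} (P : LittlewoodPaley d) : ∃ C : ℝ, 0 ≤ C ∧
    ∀ (p : ℝ≥0∞) [Fact (1 ≤ p)] (m : ℕ) (f : PerSmooth d) (t : EuclideanSpace ℝ (Fin d)),
      lpNorm p (translate t.ofLp (block P m f) - block P m f)
        ≤ C * 2 ^ m * ‖t‖ * lpNorm p (block P m f) := by
  obtain ⟨C, hC0, hC⟩ := exists_lpNorm_translate_block_sub_le P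
  refine ⟨11 * (C * 2 ^ 5), by positivity, fun p _ m f t => ?_⟩
  have e : translate t.ofLp (block P m f) - block P m f = ∑ l ∈ window m,
      (translate t.ofLp (block P l (block P m f)) - block P l (block P m f)) := by
    conv_lhs => rw [block_eq_sum_window_right P m f, translate_sum]
    rw [Finset.sum_sub_distrib]
  rw [e]
  refine (lpNorm_sum_le p _ _).trans ?_
  have hN := lpNorm_nonneg p (block P m f)
  have hl : ∀ l ∈ window m,
      lpNorm p (translate t.ofLp (block P l (block P m f)) - block P l (block P m f))
        ≤ C * 2 ^ 5 * 2 ^ m * ‖t‖ * lpNorm p (block P m f) := fun l hl => by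
    have h1 : (2 : ℝ) ^ l ≤ 2 ^ 5 * 2 ^ m := by
      rw [← pow_add]
      exact pow_le_pow_right₀ one_le_two (by rw [mem_window] at hl; omega)
    calc _ ≤ C * 2 ^ l * ‖t‖ * lpNorm p (block P m f) := hC p l _ t
      _ ≤ C * (2 ^ 5 * 2 ^ m) * ‖t‖ * lpNorm p (block P m f) := by gcongr
      _ = _ := by ring
  refine (Finset.sum_le_card_nsmul _ _ _ hl).trans ?_
  rw [nsmul_eq_mul]
  have hc : ((window m).card : ℝ) ≤ 11 := by exact_mod_cast card_window_le m
  calc _ ≤ (11 : ℝ) * (C * 2 ^ 5 * 2 ^ m * ‖t‖ * lpNorm p (block P m f)) := by gcongr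
    _ = _ := by ring

/-- The partial sums of the Littlewood-Paley decomposition. -/
noncomputable def lowSum {d : ℕ} (P : LittlewoodPaley d) (L : ℕ) (f : PerSmooth d) : PerSmooth d :=
  ∑ j ∈ Finset.range L, block P j f

theorem spectrumLT_lowSum {d : ℕ} (P : LittlewoodPaley d) (L : ℕ) (f : PerSmooth d) :
    SpectrumLT (lowSum P L f) (4 / 3 * 2 ^ L) :=
  SpectrumLT.sum fun j hj => (spectrumLT_block P j f).mono (by
    have : (2 : ℝ) ^ j ≤ 2 ^ L := pow_le_pow_right₀ one_le_two (Finset.mem_range.1 hj).le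
    linarith)

theorem sum_geometric_le {ι : Type*} {x : ℝ} (hx0 : 0 ≤ x) (hx1 : x < 1) (s : Finset ι)
    {e : ι → ℕ} (he : Set.InjOn e s) : ∑ q ∈ s, x ^ e q ≤ (1 - x)⁻¹ := by
  classical
  rw [← Finset.sum_image (f := fun j => x ^ j) he, ← tsum_geometric_of_lt_one hx0 hx1]
  exact (summable_geometric_of_lt_one hx0 hx1).sum_le_tsum _ fun _ _ => by positivity

/-- The remainder is the series of blocks from L on, a geometric tail because a < 1, that is α > 0.
-/
theorem lpNorm_sub_lowSum_le {d : ℕ} (P : LittlewoodPaley d) (p : ℝ≥0∞) [Fact (1 ≤ p)]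
    {f : PerSmooth d} {A a : ℝ} (hA : 0 ≤ A) (ha0 : 0 < a) (ha1 : a < 1)
    (hf : ∀ j, lpNorm p (block P j f) ≤ A * a ^ j) (L : ℕ) :
    lpNorm p (f - lowSum P L f) ≤ A * (1 - a)⁻¹ * a ^ L := by
  obtain ⟨C, -, hC⟩ := exists_norm_block_le_two_pow_inv P f
  refine lpNorm_le_of_hasSum p (T := fun j => block P (j + L) f)
    ((summable_nat_add_iff L).2 (summable_two_pow_inv_mul C)) (fun j => hC (j + L))
    (fun x => ?_) fun s => ?_
  · have h := (hasSum_nat_add_iff' L).2 (hasSum_block_apply P f x)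
    have e : ((f - lowSum P L f : PerSmooth d) : (Fin d → ℝ) → ℂ) x = (f : (Fin d → ℝ) → ℂ) x
        - ∑ j ∈ Finset.range L, (block P j f : (Fin d → ℝ) → ℂ) x := by simp [lowSum]
    rw [e]
    exact h
  · refine (lpNorm_sum_le p _ _).trans ?_
    calc ∑ j ∈ s, lpNorm p (block P (j + L) f) ≤ ∑ j ∈ s, A * a ^ L * a ^ j :=
          Finset.sum_le_sum fun j _ => (hf (j + L)).trans_eq (by rw [pow_add]; ring)
      _ = A * a ^ L * ∑ j ∈ s, a ^ j := by rw [Finset.mul_sum]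
      _ ≤ A * a ^ L * (1 - a)⁻¹ := by
          gcongr
          exact sum_geometric_le ha0.le ha1 s (e := fun j => j) (fun _ _ _ _ h => h)
      _ = _ := by ring

theorem geom_sum_le {x : ℝ} (hx : 1 < x) (n : ℕ) :
    ∑ j ∈ Finset.range n, x ^ j ≤ (x - 1)⁻¹ * x ^ n := by
  have h : 0 < x - 1 := sub_pos.2 hx
  rw [geom_sum_eq hx.ne', div_eq_inv_mul]
  gcongr
  linarith

/-- Each block has L^p Lipschitz constant of order 2^j a^j. As 2a > 1, that is α < 1, the last terms
dominate the sum. -/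
theorem exists_lpNorm_translate_lowSum_sub_le {d : ℕ} (P : LittlewoodPaley d) {a : ℝ}
    (ha : 1 < 2 * a) : ∃ C : ℝ, 0 ≤ C ∧ ∀ (p : ℝ≥0∞) [Fact (1 ≤ p)]
    (f : PerSmooth d) (A : ℝ), 0 ≤ A → (∀ j, lpNorm p (block P j f) ≤ A * a ^ j) →
      ∀ (L : ℕ) (t : EuclideanSpace ℝ (Fin d)),
        lpNorm p (translate t.ofLp (lowSum P L f) - lowSum P L f)
          ≤ C * A * (2 * a) ^ L * ‖t‖ := by
  obtain ⟨C, hC0, hC⟩ := exists_lpNorm_translate_block_sub_le' P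
  have ha' : 0 < 2 * a - 1 := sub_pos.2 ha
  refine ⟨C * (2 * a - 1)⁻¹, by positivity, fun p _ f A hA hf L t => ?_⟩
  have e : translate t.ofLp (lowSum P L f) - lowSum P L f = ∑ j ∈ Finset.range L,
      (translate t.ofLp (block P j f) - block P j f) := by
    rw [lowSum, translate_sum, Finset.sum_sub_distrib]
  rw [e]
  refine (lpNorm_sum_le p _ _).trans ?_
  calc _ ≤ ∑ j ∈ Finset.range L, C * A * ‖t‖ * (2 * a) ^ j := by
        refine Finset.sum_le_sum fun j _ => (hC p j f t).trans ?_
        calc _ ≤ C * 2 ^ j * ‖t‖ * (A * a ^ j) := by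
              gcongr
              exact hf j
          _ = _ := by rw [mul_pow]; ring
    _ = C * A * ‖t‖ * ∑ j ∈ Finset.range L, (2 * a) ^ j := by rw [Finset.mul_sum]
    _ ≤ C * A * ‖t‖ * ((2 * a - 1)⁻¹ * (2 * a) ^ L) := by
        gcongr
        exact geom_sum_le ha L
    _ = _ := by ring

/-! ### The paraproduct defect -/

/-- Since 2^j ≤ 2^l / 4, the product has spectrum between (3/8 - 1/3) 2^l = 2^l / 24 and (5/3) 2^l.
The window radius 5 comes from the lower bound: 2^5 / 24 = 4/3 is exactly the outer radius factor of
δ_i. -/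
theorem block_mul_block_eq_zero {d : ℕ} (P : LittlewoodPaley d) {i j l : ℕ} (hjl : j + 1 < l)
    (hl : l ∉ window i) (f g : PerSmooth d) : block P i (block P j f * block P l g) = 0 := by
  rw [mem_window, not_and_or, not_le, not_le] at hl
  have hj : (2 : ℝ) ^ j * 4 ≤ 2 ^ l := by
    have : (2 : ℝ) ^ (j + 2) ≤ 2 ^ l := pow_le_pow_right₀ one_le_two hjl
    rw [pow_add] at this
    linarith
  have hl0 := pow_pos (two_pos : (0 : ℝ) < 2) l
  rcases hl with h | h
  · refine ((spectrumLT_block P j f).mul (spectrumLT_block P l g)).block_eq_zero P (by omega) ?_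
    have : (2 : ℝ) ^ (l + 5) ≤ 2 ^ i := pow_le_pow_right₀ one_le_two h.le
    rw [pow_add] at this
    linarith
  · refine ((spectrumLT_block P j f).mul_spectrumGE
      (spectrumGE_block P (by omega) g)).block_eq_zero P ?_
    have : (2 : ℝ) ^ (i + 5) ≤ 2 ^ l := pow_le_pow_right₀ one_le_two h.le
    rw [pow_add] at this
    linarith

theorem block_paraproduct {d : ℕ} (P : LittlewoodPaley d) (i : ℕ) (f g : PerSmooth d) :
    block P i (paraproduct P f g)
      = ∑ l ∈ window i, block P i (lowSum P (l - 1) f * block P l g) := by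
  obtain ⟨C, hC⟩ := exists_block_mul_block_le P f g 0
  ext x
  have h := hasSum_block P i (T := fun q : {q : ℕ × ℕ | q.1 + 1 < q.2} =>
      block P q.1.1 f * block P q.1.2 g)
    ((summable_two_pow_inv.mul_right C).subtype _) (fun q y => by
      have := hC q.1 y
      rw [norm_iteratedFDeriv_zero] at this
      exact this) (hasSum_blockSum P {q | q.1 + 1 < q.2} f g) x
  rw [show (fun q : {q : ℕ × ℕ | q.1 + 1 < q.2} =>
      (block P i (block P q.1.1 f * block P q.1.2 g) : (Fin d → ℝ) → ℂ) x)
    = (fun q : ℕ × ℕ => (block P i (block P q.1 f * block P q.2 g) : (Fin d → ℝ) → ℂ) x) ∘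
      Subtype.val from rfl, hasSum_subtype_iff_indicator] at h
  -- Only the pairs (j, l) with l in the window and j < l - 1 survive; truncated subtraction is
  -- harmless, since j < l - 1 and j + 1 < l agree also at l = 0.
  have h2 := h.unique (hasSum_sum_of_ne_finset_zero
    (s := (window i).biUnion fun l => (Finset.range (l - 1)).map ⟨fun j => (j, l), fun _ _ h => by
      simpa using h⟩) fun q hq => ?_)
  · refine h2.trans ?_
    rw [Finset.sum_biUnion]
    · simp only [lowSum, Finset.sum_mul, map_sum, Finset.sum_map]
      rw [AddSubmonoidClass.coe_finsetSum, Finset.sum_apply]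
      refine Finset.sum_congr rfl fun l _ => ?_
      rw [AddSubmonoidClass.coe_finsetSum, Finset.sum_apply]
      refine Finset.sum_congr rfl fun j hj => ?_
      rw [Finset.mem_range] at hj
      exact Set.indicator_of_mem (s := {q : ℕ × ℕ | q.1 + 1 < q.2}) (a := (j, l))
        (show j + 1 < l by omega) _
    · intro l _ l' _ hll
      rw [Function.onFun, Finset.disjoint_left]
      intro q hq hq'
      simp only [Finset.mem_map] at hq hq'
      obtain ⟨j, -, rfl⟩ := hq
      obtain ⟨j', -, h'⟩ := hq'
      exact hll (congrArg Prod.snd h').symm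
  · by_cases hq1 : q.1 + 1 < q.2
    · rw [Set.indicator_of_mem (by exact hq1)]
      have hw : q.2 ∉ window i := fun hw => hq (by
        simp only [Finset.mem_biUnion, Finset.mem_map, Finset.mem_range]
        exact ⟨q.2, hw, q.1, by omega, rfl⟩)
      rw [block_mul_block_eq_zero P hq1 hw]
      rfl
    · exact Set.indicator_of_notMem (s := {q : ℕ × ℕ | q.1 + 1 < q.2}) (a := q) hq1 _

/-- The difference `δ_{i-1} (f ≺ g) - f δ_{i-1} g`. -/
noncomputable def paraDefect {d : ℕ} (P : LittlewoodPaley d) (i : ℕ) (f g : PerSmooth d) :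
    PerSmooth d :=
  block P i (paraproduct P f g) - f * block P i g

/-- Adding and subtracting S δ_i δ_l g, with S the low frequencies of f below l - 1, separates a
commutator, which gains from the regularity of S, from a high-frequency remainder of f. -/
theorem paraDefect_eq {d : ℕ} (P : LittlewoodPaley d) (i : ℕ) (f g h : PerSmooth d) :
    paraDefect P i f g * h = ∑ l ∈ window i,
      ((block P i (lowSum P (l - 1) f * block P l g)
          - lowSum P (l - 1) f * block P i (block P l g)) * h
        - (f - lowSum P (l - 1) f) * block P i (block P l g) * h) := by
  unfold paraDefect
  rw [block_paraproduct]
  conv_lhs => rw [block_eq_sum_window_left P i g]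
  rw [Finset.mul_sum, ← Finset.sum_sub_distrib, Finset.sum_mul]
  exact Finset.sum_congr rfl fun l _ => by ring

/-- In each of the at most eleven terms, the commutator is of order 2^(-i) (2a)^i = a^i and the
remainder f - S is of order a^i; g and h contribute b^i and c^i. The window lemma replaces l and k
by i in all exponents. -/
theorem exists_lpNorm_paraDefect_mul_le {d : ℕ} (P : LittlewoodPaley d) {p p₁ p₂ p₃ : ℝ≥0∞}
    [Fact (1 ≤ p)] [Fact (1 ≤ p₁)] [Fact (1 ≤ p₂)] (hp : p⁻¹ = p₁⁻¹ + p₂⁻¹ + p₃⁻¹) {a b c : ℝ}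
    (ha0 : 0 < a) (ha1 : a < 1) (ha2 : 1 < 2 * a) (hb0 : 0 < b) (hc0 : 0 < c) :
    ∃ K : ℝ, 0 ≤ K ∧ ∀ (f g h : PerSmooth d) (A B D : ℝ), 0 ≤ A → 0 ≤ B → 0 ≤ D →
      (∀ j, lpNorm p₁ (block P j f) ≤ A * a ^ j) → (∀ j, lpNorm p₂ (block P j g) ≤ B * b ^ j) →
      (∀ j, lpNorm p₃ (block P j h) ≤ D * c ^ j) → ∀ i k, k ∈ window i →
        lpNorm p (paraDefect P i f g * block P k h) ≤ K * (A * B * D) * (a * b * c) ^ i := by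
  obtain ⟨C₁, hC₁, hcomm⟩ := exists_lpNorm_commutator_mul_le P
  obtain ⟨C₂, hC₂, hlip⟩ := exists_lpNorm_translate_lowSum_sub_le P ha2
  obtain ⟨C₃, hC₃, hblock⟩ := exists_lpNorm_block_le P
  have h1a : 0 < 1 - a := sub_pos.2 ha1
  let M : ℝ → ℝ := fun x => (x + x⁻¹) ^ 5
  have hM : ∀ x, 0 < x → 0 ≤ M x := fun x hx => by positivity
  have hMa := hM a ha0
  have hMb := hM b hb0
  have hMc := hM c hc0
  have hM2a := hM (2 * a) (by positivity)
  set K₁ := C₁ * C₂ * M (2 * a) * M b * M c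
  set K₂ := C₃ * (1 - a)⁻¹ * a⁻¹ * M a * M b * M c
  have hK₁ : 0 ≤ K₁ := by positivity
  have hK₂ : 0 ≤ K₂ := by positivity
  refine ⟨11 * (K₁ + K₂), by positivity, fun f g h A B D hA hB hD hf hg hh i k hk => ?_⟩
  rw [paraDefect_eq]
  refine (lpNorm_sum_le p _ _).trans ?_
  have hterm : ∀ l ∈ window i, lpNorm p ((block P i (lowSum P (l - 1) f * block P l g)
          - lowSum P (l - 1) f * block P i (block P l g)) * block P k h
        - (f - lowSum P (l - 1) f) * block P i (block P l g) * block P k h)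
      ≤ (K₁ + K₂) * (A * B * D) * (a * b * c) ^ i := by
    intro l hl
    have hbl : lpNorm p₂ (block P l g) ≤ B * (M b * b ^ i) :=
      (hg l).trans (mul_le_mul_of_nonneg_left (pow_le_of_mem_window hb0 hl) hB)
    have hck : lpNorm p₃ (block P k h) ≤ D * (M c * c ^ i) :=
      (hh k).trans (mul_le_mul_of_nonneg_left (pow_le_of_mem_window hc0 hk) hD)
    have h2al : (2 * a) ^ (l - 1) ≤ M (2 * a) * (2 * a) ^ i :=
      (pow_le_pow_right₀ ha2.le (Nat.sub_le l 1)).trans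
        (pow_le_of_mem_window (by positivity) hl)
    -- The inequality l ≤ (l - 1) + 1 suffices as a < 1, and it covers l = 0, where l - 1 is 0.
    have hal : a ^ (l - 1) ≤ a⁻¹ * (M a * a ^ i) := by
      refine le_trans ?_ (mul_le_mul_of_nonneg_left (pow_le_of_mem_window ha0 hl)
        (inv_pos.2 ha0).le)
      rw [← div_eq_inv_mul, le_div_iff₀ ha0, ← pow_succ]
      exact pow_le_pow_of_le_one ha0.le ha1.le (by omega)
    have n2 := lpNorm_nonneg p₂ (block P l g)
    have n3 := lpNorm_nonneg p₃ (block P k h)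
    have e1 : lpNorm p ((block P i (lowSum P (l - 1) f * block P l g)
        - lowSum P (l - 1) f * block P i (block P l g)) * block P k h)
        ≤ K₁ * (A * B * D) * (a * b * c) ^ i := by
      refine (hcomm p p₁ p₂ p₃ hp i _ _ _ (C₂ * A * (2 * a) ^ (l - 1)) (by positivity)
        (hlip p₁ f A hA hf (l - 1))).trans ?_
      calc C₁ * (2 ^ i)⁻¹ * (C₂ * A * (2 * a) ^ (l - 1)) * lpNorm p₂ (block P l g) *
            lpNorm p₃ (block P k h)
          ≤ C₁ * (2 ^ i)⁻¹ * (C₂ * A * (M (2 * a) * (2 * a) ^ i)) * (B * (M b * b ^ i)) *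
            (D * (M c * c ^ i)) := by gcongr
        _ = K₁ * (A * B * D) * (a * b * c) ^ i := by
          simp only [K₁, mul_pow]
          field_simp
    have e2 : lpNorm p ((f - lowSum P (l - 1) f) * block P i (block P l g) * block P k h)
        ≤ K₂ * (A * B * D) * (a * b * c) ^ i := by
      refine (lpNorm_mul_mul_le hp _ _ _).trans ?_
      have t1 := lpNorm_sub_lowSum_le P p₁ hA ha0 ha1 hf (l - 1)
      have t2 := hblock p₂ i (block P l g)
      have n4 := lpNorm_nonneg p₂ (block P i (block P l g))
      calc lpNorm p₁ (f - lowSum P (l - 1) f) * lpNorm p₂ (block P i (block P l g)) *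
            lpNorm p₃ (block P k h)
          ≤ (A * (1 - a)⁻¹ * (a⁻¹ * (M a * a ^ i))) * (C₃ * (B * (M b * b ^ i))) *
            (D * (M c * c ^ i)) := by
            gcongr
            · exact t1.trans (by gcongr)
            · exact t2.trans (by gcongr)
        _ = K₂ * (A * B * D) * (a * b * c) ^ i := by
          simp only [K₂, mul_pow]
          ring
    refine (lpNorm_sub_le p _ _).trans ((add_le_add e1 e2).trans_eq ?_)
    ring
  refine (Finset.sum_le_card_nsmul _ _ _ hterm).trans ?_
  rw [nsmul_eq_mul]
  have hc : ((window i).card : ℝ) ≤ 11 := by exact_mod_cast card_window_le i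
  calc _ ≤ (11 : ℝ) * ((K₁ + K₂) * (A * B * D) * (a * b * c) ^ i) := by gcongr
    _ = _ := by ring

/-- Both δ_i(f ≺ g) δ_k h and S δ_i g δ_k h, with S the blocks of f below r - 3, have spectrum below
the inner radius (3/8) 2^r: the blocks at i and k add at most 4 · 2^i ≤ 2^r / 8, and S adds 2^r / 6.
-/
theorem block_paraDefect_mul_eq {d : ℕ} (P : LittlewoodPaley d) {i k r : ℕ} (hk : k ≤ i + 1)
    (hr : i + 5 ≤ r) (f g h : PerSmooth d) : block P r (paraDefect P i f g * block P k h)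
      = -block P r ((f - lowSum P (r - 3) f) * block P i g * block P k h) := by
  have h0 := pow_pos (two_pos : (0 : ℝ) < 2) i
  have hk2 : (2 : ℝ) ^ k ≤ 2 * 2 ^ i := by
    rw [← pow_succ']
    exact pow_le_pow_right₀ one_le_two hk
  have hr2 : (2 : ℝ) ^ i * 32 ≤ 2 ^ r := by
    have : (2 : ℝ) ^ (i + 5) ≤ 2 ^ r := pow_le_pow_right₀ one_le_two hr
    rw [pow_add] at this
    linarith
  have hr3 : (2 : ℝ) ^ r = 2 ^ (r - 3) * 8 := by
    obtain ⟨e, rfl⟩ := Nat.exists_eq_add_of_le (show 3 ≤ r by omega)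
    rw [Nat.add_sub_cancel_left, pow_add]
    ring
  have z1 : block P r (block P i (paraproduct P f g) * block P k h) = 0 :=
    ((spectrumLT_block P i _).mul (spectrumLT_block P k h)).block_eq_zero P (by omega)
      (by linarith)
  have z2 : block P r (lowSum P (r - 3) f * (block P i g * block P k h)) = 0 :=
    ((spectrumLT_lowSum P (r - 3) f).mul ((spectrumLT_block P i g).mul
      (spectrumLT_block P k h))).block_eq_zero P (by omega) (by linarith)
  have e : paraDefect P i f g * block P k h = block P i (paraproduct P f g) * block P k h
      - (f - lowSum P (r - 3) f) * block P i g * block P k h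
      - lowSum P (r - 3) f * (block P i g * block P k h) := by
    unfold paraDefect
    ring
  rw [e, map_sub, map_sub, z1, z2, zero_sub, sub_zero]

/-- Here f enters through its tail beyond r rather than beyond i, so its factor a^r does not depend
on i. This is what makes the sum over the small i comparable with its value at i = r. -/
theorem exists_lpNorm_block_paraDefect_mul_le {d : ℕ} (P : LittlewoodPaley d)
    {p p₁ p₂ p₃ : ℝ≥0∞} [Fact (1 ≤ p)] [Fact (1 ≤ p₁)] (hp : p⁻¹ = p₁⁻¹ + p₂⁻¹ + p₃⁻¹)
    {a b c : ℝ} (ha0 : 0 < a) (ha1 : a < 1) (hb0 : 0 < b) (hc0 : 0 < c) :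
    ∃ K : ℝ, 0 ≤ K ∧ ∀ (f g h : PerSmooth d) (A B D : ℝ), 0 ≤ A → 0 ≤ B → 0 ≤ D →
      (∀ j, lpNorm p₁ (block P j f) ≤ A * a ^ j) → (∀ j, lpNorm p₂ (block P j g) ≤ B * b ^ j) →
      (∀ j, lpNorm p₃ (block P j h) ≤ D * c ^ j) → ∀ i k r, i ≤ k + 1 → k ≤ i + 1 → i + 5 ≤ r →
        lpNorm p (block P r (paraDefect P i f g * block P k h))
          ≤ K * (A * B * D) * (a ^ r * (b * c) ^ i) := by
  obtain ⟨C₃, hC₃, hblock⟩ := exists_lpNorm_block_le P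
  have h1a : 0 < 1 - a := sub_pos.2 ha1
  let M : ℝ → ℝ := fun x => (x + x⁻¹) ^ 5
  have hM : ∀ x, 0 < x → 0 ≤ M x := fun x hx => by positivity
  have hMa := hM a ha0
  have hMc := hM c hc0
  refine ⟨C₃ * (1 - a)⁻¹ * M a * M c, by positivity,
    fun f g h A B D hA hB hD hf hg hh i k r hik hki hr => ?_⟩
  rw [block_paraDefect_mul_eq P hki hr, lpNorm_neg]
  refine (hblock p r _).trans ?_
  have t1 := lpNorm_sub_lowSum_le P p₁ hA ha0 ha1 hf (r - 3)
  have t2 : a ^ (r - 3) ≤ M a * a ^ r := pow_le_of_mem_window ha0 (by rw [mem_window]; omega)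
  have hck : lpNorm p₃ (block P k h) ≤ D * (M c * c ^ i) :=
    (hh k).trans (mul_le_mul_of_nonneg_left
      (pow_le_of_mem_window hc0 (by rw [mem_window]; omega)) hD)
  have n2 := lpNorm_nonneg p₂ (block P i g)
  have n3 := lpNorm_nonneg p₃ (block P k h)
  calc C₃ * lpNorm p ((f - lowSum P (r - 3) f) * block P i g * block P k h)
      ≤ C₃ * (lpNorm p₁ (f - lowSum P (r - 3) f) * lpNorm p₂ (block P i g) *
          lpNorm p₃ (block P k h)) := by
        gcongr
        exact lpNorm_mul_mul_le hp _ _ _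
    _ ≤ C₃ * ((A * (1 - a)⁻¹ * (M a * a ^ r)) * (B * b ^ i) * (D * (M c * c ^ i))) := by
        gcongr
        · exact t1.trans (by gcongr)
        · exact hg i
    _ = _ := by
        rw [mul_pow]
        ring

/-! ### Summation along the diagonal -/

theorem sum_pow_le_of_le_add_five {x : ℝ} (hx0 : 0 < x) (hx1 : x < 1) (r : ℕ) (s : Finset ℕ)
    (hs : ∀ i ∈ s, r ≤ i + 5) : ∑ i ∈ s, x ^ i ≤ (x ^ 5)⁻¹ * (1 - x)⁻¹ * x ^ r := by
  have e : ∀ i ∈ s, x ^ i = (x ^ 5)⁻¹ * x ^ r * x ^ (i + 5 - r) := fun i hi => by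
    have : i + 5 = r + (i + 5 - r) := by have := hs i hi; omega
    rw [mul_assoc, ← pow_add, ← this, pow_add]
    field_simp
  rw [Finset.sum_congr rfl e, ← Finset.mul_sum]
  calc _ ≤ (x ^ 5)⁻¹ * x ^ r * (1 - x)⁻¹ := by
        gcongr
        refine sum_geometric_le hx0.le hx1 s fun i hi j hj hij => ?_
        have h1 := hs i hi
        have h2 := hs j hj
        omega
    _ = _ := by ring

theorem sum_pow_le_of_le {x : ℝ} (hx : 1 < x) (r : ℕ) (s : Finset ℕ) (hs : ∀ i ∈ s, i ≤ r) :
    ∑ i ∈ s, x ^ i ≤ (x - 1)⁻¹ * x * x ^ r := by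
  have h0 : 0 < x := zero_lt_one.trans hx
  refine (Finset.sum_le_sum_of_subset_of_nonneg (t := Finset.range (r + 1)) (fun i hi => ?_)
    fun i _ _ => by positivity).trans ((geom_sum_le hx (r + 1)).trans_eq ?_)
  · rw [Finset.mem_range]
    have := hs i hi
    omega
  · rw [pow_succ]
    ring

theorem hasSum_bonyCommutator {d : ℕ} (P : LittlewoodPaley d) (f g h : PerSmooth d)
    (x : Fin d → ℝ) : HasSum (fun q : {q : ℕ × ℕ | q.1 ≤ q.2 + 1 ∧ q.2 ≤ q.1 + 1} =>
      ((paraDefect P q.1.1 f g * block P q.1.2 h : PerSmooth d) : (Fin d → ℝ) → ℂ) x)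
      ((bonyCommutator P f g h : (Fin d → ℝ) → ℂ) x) := by
  have h1 := hasSum_blockSum P {q | q.1 ≤ q.2 + 1 ∧ q.2 ≤ q.1 + 1} (paraproduct P f g) h x
  have h2 := (hasSum_blockSum P {q | q.1 ≤ q.2 + 1 ∧ q.2 ≤ q.1 + 1} g h x).mul_left
    ((f : (Fin d → ℝ) → ℂ) x)
  refine (h1.sub h2).congr_fun fun q => ?_
  change ((block P q.1.1 (paraproduct P f g) : (Fin d → ℝ) → ℂ) x
    - (f : (Fin d → ℝ) → ℂ) x * (block P q.1.1 g : (Fin d → ℝ) → ℂ) x) *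
      (block P q.1.2 h : (Fin d → ℝ) → ℂ) x = _
  ring

/-- A qualitative bound whose constant depends on the smooth functions; it only justifies exchanging
blocks and L^p bounds with the series, and does not enter the final estimate. -/
theorem exists_norm_paraDefect_mul_le {d : ℕ} (P : LittlewoodPaley d) (f g h : PerSmooth d) :
    ∃ C : ℝ, ∀ (q : ℕ × ℕ) x,
      ‖((paraDefect P q.1 f g * block P q.2 h : PerSmooth d) : (Fin d → ℝ) → ℂ) x‖
        ≤ (2 ^ q.1)⁻¹ * (2 ^ q.2)⁻¹ * C := by
  obtain ⟨C₁, hC₁⟩ := exists_block_mul_block_le P (paraproduct P f g) h 0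
  obtain ⟨C₂, hC₂⟩ := exists_block_mul_block_le P g h 0
  obtain ⟨M, hM⟩ := exists_norm_le f
  have hM0 : 0 ≤ M := (norm_nonneg _).trans (hM 0)
  refine ⟨C₁ + M * C₂, fun q x => ?_⟩
  have h1 := hC₁ q x
  have h2 := hC₂ q x
  rw [norm_iteratedFDeriv_zero] at h1 h2
  have e : ((paraDefect P q.1 f g * block P q.2 h : PerSmooth d) : (Fin d → ℝ) → ℂ) x
      = (block P q.1 (paraproduct P f g) : (Fin d → ℝ) → ℂ) x *
        (block P q.2 h : (Fin d → ℝ) → ℂ) x - (f : (Fin d → ℝ) → ℂ) x *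
        ((block P q.1 g : (Fin d → ℝ) → ℂ) x * (block P q.2 h : (Fin d → ℝ) → ℂ) x) := by
    change ((block P q.1 (paraproduct P f g) : (Fin d → ℝ) → ℂ) x
      - (f : (Fin d → ℝ) → ℂ) x * (block P q.1 g : (Fin d → ℝ) → ℂ) x) *
        (block P q.2 h : (Fin d → ℝ) → ℂ) x = _
    ring
  rw [e]
  refine (norm_sub_le _ _).trans ?_
  rw [norm_mul ((f : (Fin d → ℝ) → ℂ) x)]
  calc _ ≤ (2 ^ q.1)⁻¹ * (2 ^ q.2)⁻¹ * C₁ + M * ((2 ^ q.1)⁻¹ * (2 ^ q.2)⁻¹ * C₂) := by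
        gcongr
        exact hM x
    _ = _ := by ring

/-- Each first index i is shared by at most three pairs, those with second index i - 1, i or i + 1.
-/
theorem sum_near_diagonal_le (s : Finset {q : ℕ × ℕ | q.1 ≤ q.2 + 1 ∧ q.2 ≤ q.1 + 1}) {t : ℕ → ℝ}
    (ht : ∀ i, 0 ≤ t i) :
    ∑ q ∈ s, t q.1.1 ≤ 3 * ∑ i ∈ s.image (fun q => q.1.1), t i := by
  classical
  rw [Finset.sum_comp t (fun q : {q : ℕ × ℕ | q.1 ≤ q.2 + 1 ∧ q.2 ≤ q.1 + 1} => q.1.1),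
    Finset.mul_sum]
  refine Finset.sum_le_sum fun i _ => ?_
  rw [nsmul_eq_mul]
  refine mul_le_mul_of_nonneg_right ?_ (ht i)
  have : (s.filter fun q => q.1.1 = i).card ≤ (Finset.Icc (i - 1) (i + 1)).card := by
    refine Finset.card_le_card_of_injOn (fun q => q.1.2) (fun q hq => ?_) fun q hq q' hq' h => ?_
    · have h1 := (Finset.mem_filter.1 hq).2
      have h2 := q.2
      simp only [Set.mem_ofPred_eq] at h2
      simp only [Finset.coe_Icc, Set.mem_Icc]
      omega
    · have h1 := (Finset.mem_filter.1 hq).2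
      have h2 := (Finset.mem_filter.1 hq').2
      exact Subtype.ext (Prod.ext (h1.trans h2.symm) h)
  rw [Nat.card_Icc] at this
  have h3 : (s.filter fun q => q.1.1 = i).card ≤ 3 := by omega
  exact_mod_cast h3

theorem exists_lpNorm_block_bonyCommutator_le {d : ℕ} (P : LittlewoodPaley d)
    {p p₁ p₂ p₃ : ℝ≥0∞} [Fact (1 ≤ p)] [Fact (1 ≤ p₁)] [Fact (1 ≤ p₂)]
    (hp : p⁻¹ = p₁⁻¹ + p₂⁻¹ + p₃⁻¹) {a b c : ℝ} (ha0 : 0 < a) (ha2 : 1 < 2 * a) (hb0 : 0 < b)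
    (hc0 : 0 < c) (hbc : 1 < b * c) (habc : a * b * c < 1) :
    ∃ K : ℝ, 0 ≤ K ∧ ∀ (f g h : PerSmooth d) (A B D : ℝ), 0 ≤ A → 0 ≤ B → 0 ≤ D →
      (∀ j, lpNorm p₁ (block P j f) ≤ A * a ^ j) → (∀ j, lpNorm p₂ (block P j g) ≤ B * b ^ j) →
      (∀ j, lpNorm p₃ (block P j h) ≤ D * c ^ j) → ∀ r,
        lpNorm p (block P r (bonyCommutator P f g h)) ≤ K * (A * B * D) * (a * b * c) ^ r := by
  -- From a (bc) < 1 < bc: positivity of α is a consequence of the hypotheses.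
  have ha1 : a < 1 := by nlinarith
  obtain ⟨K₁, hK₁, h1⟩ := exists_lpNorm_paraDefect_mul_le P hp ha0 ha1 ha2 hb0 hc0
  obtain ⟨K₂, hK₂, h2⟩ := exists_lpNorm_block_paraDefect_mul_le P hp ha0 ha1 hb0 hc0
  obtain ⟨C₃, hC₃, hblock⟩ := exists_lpNorm_block_le P
  have hbc' : 0 < b * c - 1 := sub_pos.2 hbc
  have habc' : 0 < 1 - a * b * c := sub_pos.2 habc
  set S₁ := ((a * b * c) ^ 5)⁻¹ * (1 - a * b * c)⁻¹
  set S₂ := (b * c - 1)⁻¹ * (b * c)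
  refine ⟨3 * (C₃ * K₁ * S₁ + K₂ * S₂), by positivity,
    fun f g h A B D hA hB hD hf hg hh r => ?_⟩
  obtain ⟨M, hM⟩ := exists_norm_paraDefect_mul_le P f g h
  obtain ⟨C₄, hC₄, hsup⟩ := exists_norm_block_le P
  set N := A * B * D
  have hN : 0 ≤ N := by positivity
  -- The majorant t₁ handles i ≥ r - 5, where the bound (abc)^i decays; t₂ handles smaller i, where
  -- a^r (bc)^i grows towards i = r.
  let t₁ : ℕ → ℝ := fun i => if r ≤ i + 5 then C₃ * K₁ * N * (a * b * c) ^ i else 0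
  let t₂ : ℕ → ℝ := fun i => if i ≤ r then K₂ * N * a ^ r * (b * c) ^ i else 0
  have ht₁ : ∀ i, 0 ≤ t₁ i := fun i => by
    simp only [t₁]
    split_ifs <;> positivity
  have ht₂ : ∀ i, 0 ≤ t₂ i := fun i => by
    simp only [t₂]
    split_ifs <;> positivity
  refine lpNorm_le_of_hasSum p
    (T := fun q : {q : ℕ × ℕ | q.1 ≤ q.2 + 1 ∧ q.2 ≤ q.1 + 1} =>
      block P r (paraDefect P q.1.1 f g * block P q.1.2 h))
    (((summable_two_pow_inv.mul_right M).subtype _).mul_left C₄)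
    (fun q => hsup r _ _ (hM q.1))
    (hasSum_block P r ((summable_two_pow_inv.mul_right M).subtype _) (fun q => hM q.1)
      (hasSum_bonyCommutator P f g h)) fun s => ?_
  refine (lpNorm_sum_le p _ _).trans ?_
  have hterm : ∀ q ∈ s, lpNorm p (block P r (paraDefect P q.1.1 f g * block P q.1.2 h))
      ≤ t₁ q.1.1 + t₂ q.1.1 := fun q _ => by
    have hq := q.2
    simp only [Set.mem_ofPred_eq] at hq
    by_cases hr : r ≤ q.1.1 + 5
    · refine le_trans ?_ (le_add_of_nonneg_right (ht₂ _))
      simp only [t₁, if_pos hr]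
      refine (hblock p r _).trans ?_
      have := h1 f g h A B D hA hB hD hf hg hh q.1.1 q.1.2 (by rw [mem_window]; omega)
      calc _ ≤ C₃ * (K₁ * N * (a * b * c) ^ q.1.1) := by gcongr
        _ = _ := by ring
    · refine le_trans ?_ (le_add_of_nonneg_left (ht₁ _))
      simp only [t₂]
      rw [if_pos (by omega)]
      refine (h2 f g h A B D hA hB hD hf hg hh q.1.1 q.1.2 r hq.1 hq.2 (by omega)).trans_eq ?_
      ring
  refine (Finset.sum_le_sum hterm).trans ((sum_near_diagonal_le s
    (t := fun i => t₁ i + t₂ i) fun i => add_nonneg (ht₁ i) (ht₂ i)).trans ?_)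
  set S := s.image fun q => q.1.1
  have b1 : ∑ i ∈ S, t₁ i ≤ C₃ * K₁ * N * (S₁ * (a * b * c) ^ r) := by
    simp only [t₁]
    rw [← Finset.sum_filter, ← Finset.mul_sum]
    gcongr
    exact sum_pow_le_of_le_add_five (by positivity) habc r _ fun i hi => (Finset.mem_filter.1 hi).2
  have b2 : ∑ i ∈ S, t₂ i ≤ K₂ * N * a ^ r * (S₂ * (b * c) ^ r) := by
    simp only [t₂]
    rw [← Finset.sum_filter, ← Finset.mul_sum]
    gcongr
    exact sum_pow_le_of_le hbc r _ fun i hi => (Finset.mem_filter.1 hi).2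
  rw [Finset.sum_add_distrib]
  calc _ ≤ 3 * (C₃ * K₁ * N * (S₁ * (a * b * c) ^ r) + K₂ * N * a ^ r * (S₂ * (b * c) ^ r)) := by
        gcongr
    _ = _ := by
        rw [mul_assoc a b c, mul_pow a]
        ring

/-! ### From geometric bounds on blocks to Besov norms -/

theorem besovNorm_nonneg {d : ℕ} (P : LittlewoodPaley d) (α : ℝ) (p : ℝ≥0∞) (f : PerSmooth d) :
    0 ≤ besovNorm P α p f :=
  Real.iSup_nonneg fun m => mul_nonneg (by positivity) (lpNorm_nonneg p _)

/-- Converts the weight 2^(αk), k = m - 1, into powers of a = 2^(-α); the shift by one is paid for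
by the factor 2^α. -/
theorem two_rpow_mul_sub_one (α : ℝ) (m : ℕ) :
    (2 : ℝ) ^ (α * ((m : ℝ) - 1)) * ((2 : ℝ) ^ α * ((2 : ℝ) ^ (-α)) ^ m) = 1 := by
  rw [← Real.rpow_mul_natCast two_pos.le, ← Real.rpow_add two_pos, ← Real.rpow_add two_pos]
  ring_nf
  exact Real.rpow_zero 2

theorem lpNorm_block_le_besovNorm {d : ℕ} (P : LittlewoodPaley d) (α : ℝ) (p : ℝ≥0∞)
    (f : PerSmooth d) (m : ℕ) :
    lpNorm p (block P m f) ≤ 2 ^ α * besovNorm P α p f * ((2 : ℝ) ^ (-α)) ^ m := by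
  have h1 := le_ciSup (bddAbove_besovNorm P α p f) m
  have h2 := two_rpow_mul_sub_one α m
  have h3 : (0 : ℝ) ≤ 2 ^ α * ((2 : ℝ) ^ (-α)) ^ m := by positivity
  calc lpNorm p (block P m f) = 2 ^ (α * ((m : ℝ) - 1)) * lpNorm p (block P m f) *
        (2 ^ α * ((2 : ℝ) ^ (-α)) ^ m) := by
        rw [mul_right_comm, h2, one_mul]
    _ ≤ besovNorm P α p f * (2 ^ α * ((2 : ℝ) ^ (-α)) ^ m) := mul_le_mul_of_nonneg_right h1 h3
    _ = _ := by ring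

theorem besovNorm_le {d : ℕ} (P : LittlewoodPaley d) (α : ℝ) (p : ℝ≥0∞) {f : PerSmooth d} {B : ℝ}
    (h : ∀ m, lpNorm p (block P m f) ≤ B * ((2 : ℝ) ^ (-α)) ^ m) :
    besovNorm P α p f ≤ (2 ^ α)⁻¹ * B := by
  refine ciSup_le fun m => ?_
  have h2 := two_rpow_mul_sub_one α m
  have h3 : (0 : ℝ) < 2 ^ α := by positivity
  calc _ ≤ (2 : ℝ) ^ (α * ((m : ℝ) - 1)) * (B * ((2 : ℝ) ^ (-α)) ^ m) := by
        gcongr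
        exact h m
    _ = (2 ^ α)⁻¹ * B * ((2 : ℝ) ^ (α * ((m : ℝ) - 1)) * (2 ^ α * ((2 : ℝ) ^ (-α)) ^ m)) := by
        field_simp
    _ = _ := by rw [h2, mul_one]

/-- The commutator estimate on smooth functions. -/
theorem exists_besovNorm_bonyCommutator_le {d : ℕ} (P : LittlewoodPaley d) {α β γ : ℝ}
    {p p₁ p₂ p₃ : ℝ≥0∞} [Fact (1 ≤ p)] [Fact (1 ≤ p₁)] [Fact (1 ≤ p₂)]
    (hα : α < 1) (hβγ : β + γ < 0) (hαβγ : 0 < α + β + γ)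
    (hp : p⁻¹ = p₁⁻¹ + p₂⁻¹ + p₃⁻¹) : ∃ K : ℝ, 0 ≤ K ∧ ∀ f g h : PerSmooth d,
      besovNorm P (α + β + γ) p (bonyCommutator P f g h)
        ≤ K * besovNorm P α p₁ f * besovNorm P β p₂ g * besovNorm P γ p₃ h := by
  have hbc : (2 : ℝ) ^ (-β) * 2 ^ (-γ) = 2 ^ (-(β + γ)) := by
    rw [← Real.rpow_add two_pos]
    ring_nf
  have habc : (2 : ℝ) ^ (-α) * 2 ^ (-β) * 2 ^ (-γ) = 2 ^ (-(α + β + γ)) := by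
    rw [← Real.rpow_add two_pos, ← Real.rpow_add two_pos]
    ring_nf
  have ha : (2 : ℝ) * 2 ^ (-α) = 2 ^ (1 - α) := by
    rw [sub_eq_add_neg, Real.rpow_add two_pos, Real.rpow_one]
  -- The conditions α < 1, β + γ < 0 and α + β + γ > 0 become 2a > 1, bc > 1 and abc < 1.
  obtain ⟨K, hK0, hK⟩ := exists_lpNorm_block_bonyCommutator_le P hp
    (a := (2 : ℝ) ^ (-α)) (b := (2 : ℝ) ^ (-β)) (c := (2 : ℝ) ^ (-γ)) (by positivity)
    (by rw [ha]; exact Real.one_lt_rpow one_lt_two (by linarith)) (by positivity) (by positivity)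
    (by rw [hbc]; exact Real.one_lt_rpow one_lt_two (by linarith))
    (by rw [habc]; exact Real.rpow_lt_one_of_one_lt_of_neg one_lt_two (by linarith))
  refine ⟨(2 ^ (α + β + γ))⁻¹ * (K * (2 ^ α * 2 ^ β * 2 ^ γ)), by positivity, fun f g h => ?_⟩
  have h1 := besovNorm_nonneg P α p₁ f
  have h2 := besovNorm_nonneg P β p₂ g
  have h3 := besovNorm_nonneg P γ p₃ h
  have := hK f g h _ _ _ (by positivity) (by positivity) (by positivity)
    (lpNorm_block_le_besovNorm P α p₁ f) (lpNorm_block_le_besovNorm P β p₂ g)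
    (lpNorm_block_le_besovNorm P γ p₃ h)
  rw [habc] at this
  refine (besovNorm_le P (α + β + γ) p this).trans_eq ?_
  ring

/-! ### Trilinearity and extension by density -/

theorem blockSum_eq_of_apply {d : ℕ} (P : LittlewoodPaley d) (A : Set (ℕ × ℕ))
    {f g F : PerSmooth d} (h : ∀ x, HasSum (fun q : A => (block P q.1.1 f : (Fin d → ℝ) → ℂ) x *
      (block P q.1.2 g : (Fin d → ℝ) → ℂ) x) ((F : (Fin d → ℝ) → ℂ) x)) :
    blockSum P A f g = F :=
  Subtype.ext (funext fun x => (hasSum_blockSum P A f g x).unique (h x))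

/-- `blockSum` as a bilinear map. -/
noncomputable def blockSumₗ {d : ℕ} (P : LittlewoodPaley d) (A : Set (ℕ × ℕ)) :
    PerSmooth d →ₗ[ℂ] PerSmooth d →ₗ[ℂ] PerSmooth d :=
  LinearMap.mk₂ ℂ (blockSum P A)
    (fun f f' g => blockSum_eq_of_apply P A fun x => by
      refine ((hasSum_blockSum P A f g x).add (hasSum_blockSum P A f' g x)).congr_fun fun q => ?_
      rw [map_add, ← add_mul]
      rfl)
    (fun c f g => blockSum_eq_of_apply P A fun x => by
      refine ((hasSum_blockSum P A f g x).mul_left c).congr_fun fun q => ?_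
      rw [map_smul, ← mul_assoc]
      rfl)
    (fun f g g' => blockSum_eq_of_apply P A fun x => by
      refine ((hasSum_blockSum P A f g x).add (hasSum_blockSum P A f g' x)).congr_fun fun q => ?_
      rw [map_add, ← mul_add]
      rfl)
    (fun c f g => blockSum_eq_of_apply P A fun x => by
      refine ((hasSum_blockSum P A f g x).mul_left c).congr_fun fun q => ?_
      rw [map_smul, mul_left_comm]
      rfl)

/-- The commutator as a trilinear map on smooth periodic functions. -/
noncomputable def bonyCommutatorₗ {d : ℕ} (P : LittlewoodPaley d) :
    PerSmooth d →ₗ[ℂ] PerSmooth d →ₗ[ℂ] PerSmooth d →ₗ[ℂ] PerSmooth d :=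
  LinearMap.mk₂ ℂ (fun f g =>
      blockSumₗ P {q | q.1 ≤ q.2 + 1 ∧ q.2 ≤ q.1 + 1} (blockSumₗ P {q | q.1 + 1 < q.2} f g)
      - (LinearMap.mul ℂ (PerSmooth d) f) ∘ₗ
        (blockSumₗ P {q | q.1 ≤ q.2 + 1 ∧ q.2 ≤ q.1 + 1} g))
    (fun f f' g => by
      simp only [map_add, LinearMap.add_apply, LinearMap.add_comp]
      abel)
    (fun c f g => by
      simp only [map_smul, LinearMap.smul_apply, LinearMap.smul_comp]
      exact LinearMap.ext fun h => (smul_sub c (_ : PerSmooth d) (_ : PerSmooth d)).symm)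
    (fun f g g' => by
      simp only [map_add, LinearMap.comp_add]
      abel)
    (fun c f g => by
      simp only [map_smul, LinearMap.comp_smul]
      exact LinearMap.ext fun h => (smul_sub c (_ : PerSmooth d) (_ : PerSmooth d)).symm)

section Extension

variable {E₁ E₂ E₃ F₁ F₂ F₃ G : Type*}
  [AddCommGroup E₁] [Module ℂ E₁] [AddCommGroup E₂] [Module ℂ E₂] [AddCommGroup E₃] [Module ℂ E₃]
  [NormedAddCommGroup F₁] [NormedSpace ℂ F₁] [NormedAddCommGroup F₂] [NormedSpace ℂ F₂]
  [NormedAddCommGroup F₃] [NormedSpace ℂ F₃] [NormedAddCommGroup G] [NormedSpace ℂ G]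
  [CompleteSpace G] {e₁ : E₁ →ₗ[ℂ] F₁} {e₂ : E₂ →ₗ[ℂ] F₂} {e₃ : E₃ →ₗ[ℂ] F₃}

/-- Extends the last variable only. Linearity in the first survives because continuous maps agreeing
on a dense range are equal, and the operator norm keeps the bound C x, so the construction can be
iterated. -/
theorem exists_linearMap_extendOfNorm (he₂ : DenseRange e₂) (B : E₁ →ₗ[ℂ] E₂ →ₗ[ℂ] G)
    {C : E₁ → ℝ} (hC0 : ∀ x, 0 ≤ C x) (hC : ∀ x y, ‖B x y‖ ≤ C x * ‖e₂ y‖) :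
    ∃ T : E₁ →ₗ[ℂ] F₂ →L[ℂ] G, (∀ x y, T x (e₂ y) = B x y) ∧ ∀ x, ‖T x‖ ≤ C x := by
  have heq : ∀ x y, (B x).extendOfNorm e₂ (e₂ y) = B x y := fun x y =>
    LinearMap.extendOfNorm_eq he₂ ⟨C x, hC x⟩ y
  have hext : ∀ S S' : F₂ →L[ℂ] G, (∀ y, S (e₂ y) = S' (e₂ y)) → S = S' := fun S S' h =>
    ContinuousLinearMap.ext fun z => congrFun
      (he₂.equalizer S.continuous S'.continuous (funext h)) z
  refine ⟨{ toFun := fun x => (B x).extendOfNorm e₂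
            map_add' := fun x x' => hext _ _ fun y => ?_
            map_smul' := fun c x => hext _ _ fun y => ?_ }, heq, fun x => ?_⟩
  · rw [_root_.add_apply, heq, heq, heq, map_add, LinearMap.add_apply]
  · rw [RingHom.id_apply, _root_.smul_apply, heq, heq, map_smul,
      LinearMap.smul_apply]
  · refine ContinuousLinearMap.opNorm_le_bound _ (hC0 x) fun z => ?_
    refine he₂.induction_on (p := fun z => ‖(B x).extendOfNorm e₂ z‖ ≤ C x * ‖z‖) z
      (isClosed_le (ContinuousLinearMap.continuous _).norm
        (continuous_const.mul continuous_norm)) fun y => ?_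
    rw [heq]
    exact hC x y

/-- A trilinear map that is bounded for the norms pulled back from dense embeddings extends to a
continuous trilinear map. -/
theorem exists_trilinear_extension (he₁ : DenseRange e₁) (he₂ : DenseRange e₂)
    (he₃ : DenseRange e₃) (B : E₁ →ₗ[ℂ] E₂ →ₗ[ℂ] E₃ →ₗ[ℂ] G) {K : ℝ} (hK : 0 ≤ K)
    (hB : ∀ x y z, ‖B x y z‖ ≤ K * ‖e₁ x‖ * ‖e₂ y‖ * ‖e₃ z‖) :
    ∃ T : F₁ →L[ℂ] F₂ →L[ℂ] F₃ →L[ℂ] G, ∀ x y z, T (e₁ x) (e₂ y) (e₃ z) = B x y z := by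
  have h3 : ∀ x, ∃ T : E₂ →ₗ[ℂ] F₃ →L[ℂ] G, (∀ y z, T y (e₃ z) = B x y z) ∧
      ∀ y, ‖T y‖ ≤ K * ‖e₁ x‖ * ‖e₂ y‖ := fun x =>
    exists_linearMap_extendOfNorm he₃ (B x) (C := fun y => K * ‖e₁ x‖ * ‖e₂ y‖)
      (fun y => by positivity) (hB x)
  choose T₃ hT₃ hT₃' using h3
  have hext : ∀ S S' : F₃ →L[ℂ] G, (∀ z, S (e₃ z) = S' (e₃ z)) → S = S' := fun S S' h =>
    ContinuousLinearMap.ext fun z => congrFun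
      (he₃.equalizer S.continuous S'.continuous (funext h)) z
  let B₂ : E₁ →ₗ[ℂ] E₂ →ₗ[ℂ] F₃ →L[ℂ] G :=
    { toFun := T₃
      map_add' := fun x x' => LinearMap.ext fun y => hext _ _ fun z => by
        rw [LinearMap.add_apply, _root_.add_apply, hT₃, hT₃, hT₃, map_add,
          LinearMap.add_apply, LinearMap.add_apply]
      map_smul' := fun c x => LinearMap.ext fun y => hext _ _ fun z => by
        rw [RingHom.id_apply, LinearMap.smul_apply, _root_.smul_apply, hT₃, hT₃,
          map_smul, LinearMap.smul_apply, LinearMap.smul_apply] }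
  -- The same lemma now extends the second variable, with values in the operators on the already
  -- completed third one.
  obtain ⟨T₂, hT₂, hT₂'⟩ := exists_linearMap_extendOfNorm he₂ B₂ (C := fun x => K * ‖e₁ x‖)
    (fun x => by positivity) hT₃'
  refine ⟨T₂.extendOfNorm e₁, fun x y z => ?_⟩
  rw [LinearMap.extendOfNorm_eq he₁ ⟨K, hT₂'⟩, hT₂]
  exact hT₃ x y z

end Extension

/-- The dense embedding of `C^∞_per` into `B^α_{p,∞}` as a linear map. -/
noncomputable def toBesovₗ {d : ℕ} (P : LittlewoodPaley d) (α : ℝ) (p : ℝ≥0∞) [Fact (1 ≤ p)] :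
    PerSmooth d →ₗ[ℂ] Besov P α p where
  toFun := toBesov P α p
  map_add' f g := UniformSpace.Completion.coe_add (α := BesovCore P α p) f g
  map_smul' c f := UniformSpace.Completion.coe_smul (X := BesovCore P α p) c f

theorem denseRange_toBesovₗ {d : ℕ} (P : LittlewoodPaley d) (α : ℝ) (p : ℝ≥0∞) [Fact (1 ≤ p)] :
    DenseRange (toBesovₗ P α p) :=
  UniformSpace.Completion.denseRange_coe (α := BesovCore P α p)

end BesovTorus

theorem propositionA8 (d : ℕ) (P : LittlewoodPaley d) (α β γ : ℝ) (p p₁ p₂ p₃ : ℝ≥0∞)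
    [Fact (1 ≤ p)] [Fact (1 ≤ p₁)] [Fact (1 ≤ p₂)] [Fact (1 ≤ p₃)]
    (hα : α < 1) (hβγ : β + γ < 0) (hαβγ : 0 < α + β + γ)
    (hp : p⁻¹ = p₁⁻¹ + p₂⁻¹ + p₃⁻¹) :
    ∃ T : Besov P α p₁ →L[ℂ] Besov P β p₂ →L[ℂ] Besov P γ p₃ →L[ℂ] Besov P (α + β + γ) p,
      ∀ f g h : PerSmooth d,
        T (toBesov P α p₁ f) (toBesov P β p₂ g) (toBesov P γ p₃ h) =
          toBesov P (α + β + γ) p (bonyCommutator P f g h) := by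
  obtain ⟨K, hK0, hK⟩ := exists_besovNorm_bonyCommutator_le P hα hβγ hαβγ hp
  refine exists_trilinear_extension (denseRange_toBesovₗ P α p₁) (denseRange_toBesovₗ P β p₂)
    (denseRange_toBesovₗ P γ p₃)
    (B := LinearMap.mk₂ ℂ (fun f g => toBesovₗ P (α + β + γ) p ∘ₗ bonyCommutatorₗ P f g)
      (fun f f' g => by rw [map_add, LinearMap.add_apply, LinearMap.comp_add])
      (fun c f g => by rw [map_smul, LinearMap.smul_apply, LinearMap.comp_smul])
      (fun f g g' => by rw [map_add, LinearMap.comp_add])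
      (fun c f g => by rw [map_smul, LinearMap.comp_smul])) hK0 fun f g h => ?_
  -- The trilinear map agrees by definition with the embedded commutator, and the embeddings are
  -- isometric for the Besov norms, so the bound needed is the estimate on smooth functions.
  change ‖toBesov P (α + β + γ) p (bonyCommutator P f g h)‖
    ≤ K * ‖toBesov P α p₁ f‖ * ‖toBesov P β p₂ g‖ * ‖toBesov P γ p₃ h‖
  simp only [norm_toBesov]
  exact hK f g h
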